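/- \textbf{Theorem (plug-and-play bounds).} \emph{Setup.} Let $\mathcal X,\mathcal Y$ be measurable spaces and $\mu$ a $\sigma$-finite measure on $\mathcal Y$. A \emph{channel} $W$ is a Markov kernel from $\mathcal X$ to $\mathcal Y$ with a jointly measurable density $W(y\mid x)$ with respect to $\mu$. Let $\mathcal W_1,\dots,\mathcal W_n$ be sets of channels. A \emph{sequentially interactive protocol} $\Pi$ using $(\mathcal W_1,\dots,\mathcal W_n)$ consists of mutually independent random variables $U$ (public) and $U_1,\dots,U_n$ (private), independent of the inputs $X_1,\dots,X_n$, and of (measurable) rules by which player $t$ selects a channel $W_t\in\mathcal W_t$ as a function of $U$, $U_t$ and the earlier messages $Y_1,\dots,Y_{t-1}$; the message $Y_t$ is then drawn from $W_t(\cdot\mid X_t)$. The \emph{transcript} is $(Y^n,U)$ with $Y^n=(Y_1,\dots,Y_n)$. Let $k\ge 1$, $\mathcal Z=\{-1,1\}^k$, and let $(p_z)_{z\in\mathcal Z}$ be probability distributions on $\mathcal X$. Write $z^{\oplus i}$ for $z$ with its $i$-th coordinate flipped. Assume: (A1) there are $\alpha\in\mathbb R$, reals $\alpha_{z,i}$ with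 $|\alpha_{z,i}|\le\alpha$, and measurable $\phi_{z,i}\colon\mathcal X\to\mathbb R$ such that for all $z\in\mathcal Z$, $i\in[k]$: $p_{z^{\oplus i}}\ll p_z$ and $\frac{dp_{z^{\oplus i}}}{dp_z}=1+\alpha_{z,i}\phi_{z,i}$; (A2) $\mathbb E_{p_z}[\phi_{z,i}\phi_{z,j}]=\mathbf 1\{i=j\}$ for all $z\in\mathcal Z$ and $i,j\in[k]$. Fix $\tau\in(0,1/2]$ and let $Z=(Z_1,\dots,Z_k)$ have independent coordinates with $\Pr[Z_i=1]=\tau$ and $\Pr[Z_i=-1]=1-\tau$. Let $p_z^{Y^n}$ be the law of $Y^n$ when $X_1,\dots,X_n$ are i.i.d. with law $p_z$, let $p_{\pm i}^{Y^n}=\mathbb E[p_Z^{Y^n}\mid Z_i=\pm1]$, and let $d_{TV}$ be the total variation distance $\sup_A|P(A)-Q(A)|$. \emph{Conclusion.} Then $$\Big(\frac1k\sum_{i=1}^k d_{TV}\big(p_{+i}^{Y^n},p_{-i}^{Y^n}\big)\Big)^2\le\frac{7}{k}\,\alpha^2\sum_{t=1}^n\sup_{z\in\mathcal Z}\sup_{W\in\mathcal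 W_t}\int_{\mathcal Y}\frac{\mathrm{Var}_{p_z}[W(y\mid X)]}{\mathbb E_{p_z}[W(y\mid X)]}\,d\mu(y),$$ where the integrand is read as $0$ where its denominator vanishes. Suppose moreover that $\sigma\ge0$ is such that for every $z$ the vector $\phi_z(X)=(\phi_{z,i}(X))_{i\in[k]}$, $X\sim p_z$, has independent coordinates and is $\sigma^2$-subgaussian, i.e. for every unit vector $v\in\mathbb R^k$ and $\lambda\in\mathbb R$, $\mathbb E\langle v,\phi_z(X)\rangle=0$ and $\mathbb E\,e^{\lambda\langle v,\phi_z(X)\rangle}\le e^{\sigma^2\lambda^2/2}$. Then $$\Big(\frac1k\sum_{i=1}^k d_{TV}\big(p_{+i}^{Y^n},p_{-i}^{Y^n}\big)\Big)^2\le\frac{14\ln 2}{k}\,\alpha^2\sigma^2\sum_{t=1}^n\sup_{z\in\mathcal Z}\sup_{W\in\mathcal W_t}I(p_z;W),$$ where $I(p_z;W)$ is the mutual information, in bits, between $X\sim p_z$ and the output of $W$ on input $X$. Both bounds also hold with the law of $Y^n$ replaced by the law of the whole transcript $(Y^n,U)$. The suprema take values in $[0,\infty]$, with the convention $0\cdot\infty=0$.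 -/

import Mathlib

open MeasureTheory ProbabilityTheory
open scoped ENNReal NNReal

namespace InfoContraction

/-! ### Generalities: total variation, mutual information -/

/-- Total variation distance `sup_A |P(A) - Q(A)|` over measurable sets. -/
noncomputable def tvDist {S : Type*} [MeasurableSpace S] (P Q : Measure S) : ℝ :=
  ⨆ A : {A : Set S // MeasurableSet A}, |P.real A.1 - Q.real A.1|

/-- A channel from `X` to `Y`, absolutely continuous with respect to the reference measure `μ`:
a Markov kernel together with its (jointly measurable) density `W(y | x)`. -/
structure Channel (X : Type*) {Y : Type*} [MeasurableSpace X] [MeasurableSpace Y]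
    (μ : Measure Y) where
  /-- the Markov kernel `W(· | x)` -/
  kernel : Kernel X Y
  isMarkovKernel : IsMarkovKernel kernel
  /-- the density `W(y | x)` -/
  density : X → Y → ℝ≥0
  measurable_density : Measurable (fun q : X × Y => density q.1 q.2)
  kernel_eq_withDensity : ∀ x, kernel x = μ.withDensity (fun y => (density x y : ℝ≥0∞))

namespace Channel

variable {X Y : Type*} [MeasurableSpace X] [MeasurableSpace Y] {μ : Measure Y}

/-- `∫ Var_p[W(y | X)] / E_p[W(y | X)] dμ(y)`, with values in `[0, ∞]`; the integrand is `0` where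
`E_p[W(y | X)] = 0`, since then the variance vanishes too. -/
noncomputable def normalizedVariance (W : Channel X μ) (p : Measure X) : ℝ≥0∞ :=
  ∫⁻ y, evariance (fun x => (W.density x y : ℝ)) p / (∫⁻ x, (W.density x y : ℝ≥0∞) ∂p) ∂μ

/-- Mutual information in bits, with values in `[0, ∞]`, between the input `X ∼ p` and the output
of the channel `W`: the Kullback-Leibler divergence of the joint law from the product of its
marginals (`klDiv` is in nats, whence the division by `ln 2`). -/
noncomputable def mutualInfo (W : Channel X μ) (p : Measure X) : ℝ≥0∞ :=
  InformationTheory.klDiv (p.compProd W.kernel) (p.prod (p.bind W.kernel)) /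
    ENNReal.ofReal (Real.log 2)

end Channel

/-! ### Sequentially interactive protocols -/

/-- A sequentially interactive protocol with `n` players using `𝒲 = (𝒲_1, …, 𝒲_n)`.
The public randomness `U` has law `publicLaw` on `𝒰`, the private randomness `U_t` of player `t`
has law `privateLaw t` on `𝒱 t`, and player `t` selects a channel from `𝒲 t` from `U = u`,
`U_t = v` and the earlier messages `h = (y_s)_{s < t}`. -/
structure SeqProtocol {X Y : Type*} [MeasurableSpace X] [MeasurableSpace Y] {μ : Measure Y}
    {n : ℕ} (𝒲 : Fin n → Set (Channel X μ))
    (𝒰 : Type*) [MeasurableSpace 𝒰] (𝒱 : Fin n → Type*) [∀ t, MeasurableSpace (𝒱 t)] where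
  publicLaw : Measure 𝒰
  isProbabilityMeasure_publicLaw : IsProbabilityMeasure publicLaw
  privateLaw : ∀ t, Measure (𝒱 t)
  isProbabilityMeasure_privateLaw : ∀ t, IsProbabilityMeasure (privateLaw t)
  /-- the channel selected by player `t` -/
  select : ∀ t : Fin n, 𝒰 → 𝒱 t → (Set.Iio t → Y) → Channel X μ
  select_mem : ∀ t u v h, select t u v h ∈ 𝒲 t
  measurable_select : ∀ t : Fin n,
    Measurable (fun q : 𝒰 × 𝒱 t × (Set.Iio t → Y) × X × Y =>
      (select t q.1 q.2.1 q.2.2.1).density q.2.2.2.1 q.2.2.2.2)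

namespace SeqProtocol

variable {X Y : Type*} [MeasurableSpace X] [MeasurableSpace Y] {μ : Measure Y} {n : ℕ}
  {𝒲 : Fin n → Set (Channel X μ)} {𝒰 : Type*} [MeasurableSpace 𝒰] {𝒱 : Fin n → Type*}
  [∀ t, MeasurableSpace (𝒱 t)]

/-- Joint law of `((U, (U_t)_t), (X^n, Y^n))` when the inputs are i.i.d. with law `p`: the variables
`U`, `U_1, …, U_n`, `X_1, …, X_n` are independent, and given those and `Y_1, …, Y_{t-1}`, the
message `Y_t` has density `W_t(· | X_t)` with respect to `μ`, where `W_t` is the channel selected by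
player `t`. -/
noncomputable def jointLaw (P : SeqProtocol 𝒲 𝒰 𝒱) (p : Measure X) :
    Measure ((𝒰 × (∀ t, 𝒱 t)) × ((Fin n → X) × (Fin n → Y))) :=
  ((P.publicLaw.prod (Measure.pi P.privateLaw)).prod
    ((Measure.pi fun _ : Fin n => p).prod (Measure.pi fun _ : Fin n => μ))).withDensity
    fun ω => ∏ t : Fin n,
      (((P.select t ω.1.1 (ω.1.2 t) (fun s : Set.Iio t => ω.2.2 s)).density
        (ω.2.1 t) (ω.2.2 t) : ℝ≥0) : ℝ≥0∞)

/-- Law of the transcript `(Y^n, U)` when the inputs are i.i.d. with law `p`. -/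
noncomputable def transcriptLaw (P : SeqProtocol 𝒲 𝒰 𝒱) (p : Measure X) :
    Measure ((Fin n → Y) × 𝒰) :=
  (P.jointLaw p).map fun ω => (ω.2.2, ω.1.1)

/-- Law of the messages `Y^n` when the inputs are i.i.d. with law `p`. -/
noncomputable def messageLaw (P : SeqProtocol 𝒲 𝒰 𝒱) (p : Measure X) : Measure (Fin n → Y) :=
  (P.jointLaw p).map fun ω => ω.2.2

end SeqProtocol

/-! ### The perturbation space `{-1, 1}^k` and the average discrepancy -/

/-- The perturbation space `{-1, 1}^k` (`ℤˣ` is `{1, -1}`). -/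
abbrev Cube (k : ℕ) : Type := Fin k → ℤˣ

/-- `z^{⊕ i}`: flip the sign of the `i`-th coordinate. -/
def flipCoord {k : ℕ} (z : Cube k) (i : Fin k) : Cube k := Function.update z i (-z i)

/-- The law on `{-1, 1}` with mass `τ` at `1` and `1 - τ` at `-1`. -/
noncomputable def rademacher (τ : ℝ) : Measure ℤˣ :=
  ENNReal.ofReal τ • Measure.dirac 1 + ENNReal.ofReal (1 - τ) • Measure.dirac (-1)

/-- The law of `Z`: independent coordinates, each with law `rademacher τ`. -/
noncomputable def cubeLaw (τ : ℝ) (k : ℕ) : Measure (Cube k) :=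
  Measure.pi fun _ => rademacher τ

/-- `E[Q_Z | Z_i = s] = ∑_z P(Z = z | Z_i = s) Q_z`. -/
noncomputable def condMixture {k : ℕ} {S : Type*} [MeasurableSpace S] (τ : ℝ)
    (Q : Cube k → Measure S) (i : Fin k) (s : ℤˣ) : Measure S :=
  ∑ z : Cube k, ProbabilityTheory.cond (cubeLaw τ k) {z' | z' i = s} {z} • Q z

/-- The average discrepancy `(1/k) ∑_i d_TV(E[Q_Z | Z_i = 1], E[Q_Z | Z_i = -1])`. -/
noncomputable def avgDiscrepancy {k : ℕ} {S : Type*} [MeasurableSpace S] (τ : ℝ)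
    (Q : Cube k → Measure S) : ℝ :=
  (1 / (k : ℝ)) * ∑ i : Fin k, tvDist (condMixture τ Q i 1) (condMixture τ Q i (-1))

/-! ### Assumptions on the family `(p_z)` -/

/-- For all `z, i`: `p_{z^{⊕ i}} ≪ p_z`, `|a_{z,i}| ≤ α`, `φ_{z,i}` is measurable, and
`dp_{z^{⊕ i}} / dp_z = 1 + a_{z,i} φ_{z,i}`. -/
def DensitiesExist {k : ℕ} {X : Type*} [MeasurableSpace X] (p : Cube k → Measure X)
    (a : Cube k → Fin k → ℝ) (φ : Cube k → Fin k → X → ℝ) (α : ℝ) : Prop :=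
  ∀ z i, p (flipCoord z i) ≪ p z ∧ |a z i| ≤ α ∧ Measurable (φ z i) ∧
    ∀ᵐ x ∂(p z), ((p (flipCoord z i)).rnDeriv (p z) x).toReal = 1 + a z i * φ z i x

/-- `E_{p_z}[φ_{z,i} φ_{z,j}] = 1_{i = j}`. -/
def OrthonormalPerturbations {k : ℕ} {X : Type*} [MeasurableSpace X] (p : Cube k → Measure X)
    (φ : Cube k → Fin k → X → ℝ) : Prop :=
  ∀ z i j, Integrable (fun x => φ z i x * φ z j x) (p z) ∧
    ∫ x, φ z i x * φ z j x ∂(p z) = if i = j then 1 else 0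

/-- A real random variable is `σ²`-subgaussian if it is centred and its moment generating function
is everywhere finite and bounded by `exp(σ² λ² / 2)`; a random vector is so if its projection on
every unit vector is. Here the vector is `φ_z(X)` with `X ∼ p_z`, and its coordinates are moreover
independent. -/
def SubgaussianIndep {k : ℕ} {X : Type*} [MeasurableSpace X] (p : Cube k → Measure X)
    (φ : Cube k → Fin k → X → ℝ) (σ : ℝ≥0) : Prop :=
  ∀ z, (∀ v : EuclideanSpace ℝ (Fin k), ‖v‖ = 1 →
      ∫ x, ∑ i, v i * φ z i x ∂(p z) = 0 ∧
      HasSubgaussianMGF (fun x => ∑ i, v i * φ z i x) (σ ^ 2) (p z)) ∧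
    iIndepFun (fun i => φ z i) (p z)

end InfoContraction

namespace InfoContraction

/-! ### Products of successive conditional densities -/

/-! The law of `Z` serves only to average. The difference of the two mixtures for coordinate `i` is
a signed average over `z` of the differences between the law for `z` and the law for its `i`-th flip
(`condMixture_real_sub`). It therefore suffices to bound, for each fixed `z`, the sum over `i` of
the total variation distances between these two laws.

Write `L_i` for the likelihood ratio of the flipped law to the law for `z`. It is a product over
players of output likelihood ratios of the selected channels. Total variation is controlled by the
triangular discrimination, which equals `4 E[1/(1+L_i)] - 2` under the law for `z`
(`abs_real_sub_withDensity_real_le`). The potential `1/(1+L)` behaves well along the protocol. If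
one more message multiplies `L` by a ratio of conditional mean one, the linear term of the expansion
vanishes and the expected potential grows by at most the conditional chi-square divergence of that
message (`lintegral_potential_step`). All `i` share the same base law, so given the past the
selected channel is common to all of them. The chi-square divergences can then be summed over `i`
before taking the worst channel (`sum_lintegral_potential_le`). If that sum is at most `C t` for
player `t`, the squared average discrepancy is at most `(2/k) ∑ C t`.

It remains to bound, for one channel, the sum over `i` of the chi-square divergences of its outputs.
The perturbations are centred and orthonormal, so Bessel's inequality at each output `y` gives `α²`
times the normalised variance. In the subgaussian case this sum is at most `α²` times the mean
squared norm of the posterior mean of `φ_z(X)`, and the Donsker-Varadhan principle with a test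
function linear in `φ_z` bounds that by `2σ²` times the mutual information in nats. -/

/-- The product `∏ t, f t (y_0, …, y_{t-1}) y_t` of successive factors. -/
def seqProd {M Y : Type*} [CommMonoid M] {n : ℕ} (f : ∀ t : Fin n, (Fin t → Y) → Y → M)
    (y : Fin n → Y) : M :=
  ∏ t : Fin n, f t (fun j => y ⟨j, j.2.trans t.2⟩) (y t)

/-- The empty history of the first player. -/
def emptyHistory {Y : Type*} {n : ℕ} : Fin ((0 : Fin (n + 1)) : ℕ) → Y := fun j => Fin.elim0 j

/-- The factors that remain once the first coordinate is fixed. -/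
def seqTail {M Y : Type*} {n : ℕ} (f : ∀ t : Fin (n + 1), (Fin t → Y) → Y → M) (b : Y)
    (t : Fin n) (h : Fin t → Y) : Y → M :=
  f t.succ (Fin.cons (α := fun _ => Y) b h)

section SeqProd

variable {M Y : Type*} {n : ℕ}

/-- This drives every induction on the number of players: freezing the first message leaves a
product of the same shape, with that message absorbed into the histories. -/
lemma seqProd_cons [CommMonoid M] (f : ∀ t : Fin (n + 1), (Fin t → Y) → Y → M) (b : Y)
    (y : Fin n → Y) :
    seqProd f (Fin.cons (α := fun _ => Y) b y) =
      f 0 emptyHistory b * seqProd (seqTail f b) y := by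
  unfold seqProd seqTail
  rw [Fin.prod_univ_succ]
  congr 1
  · congr 1
    funext j
    exact j.elim0
  · refine Finset.prod_congr rfl fun t _ => ?_
    have : (fun j : Fin (t.succ : Fin (n + 1)) =>
        (Fin.cons (α := fun _ => Y) b y : Fin (n + 1) → Y) ⟨j, j.2.trans t.succ.2⟩) =
        (Fin.cons (α := fun _ => Y) b fun j : Fin t => y ⟨j, j.2.trans t.2⟩ :
          Fin (t + 1) → Y) := by
      funext j
      refine Fin.cases (motive := fun j : Fin (t + 1) =>
        (Fin.cons (α := fun _ => Y) b y : Fin (n + 1) → Y) ⟨j, j.2.trans t.succ.2⟩ =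
        (Fin.cons (α := fun _ => Y) b fun j : Fin t => y ⟨j, j.2.trans t.2⟩ :
          Fin (t + 1) → Y) j) rfl (fun j => ?_) j
      rfl
    rw [this]
    rfl

variable [MeasurableSpace Y]

lemma measurable_cons : Measurable fun q : Y × (Fin n → Y) =>
    (Fin.cons (α := fun _ => Y) q.1 q.2 : Fin (n + 1) → Y) := by
  refine measurable_pi_lambda _ fun j => ?_
  refine Fin.cases ?_ (fun j => ?_) j
  · simpa using measurable_fst
  · exact (measurable_pi_apply j).comp measurable_snd

lemma measurable_seqProd [CommMonoid M] [MeasurableSpace M] [MeasurableMul₂ M]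
    {Z : Type*} [MeasurableSpace Z] {f : Z → ∀ t : Fin n, (Fin t → Y) → Y → M}
    (hf : ∀ t : Fin _, Measurable fun q : Z × (Fin t → Y) × Y => f q.1 t q.2.1 q.2.2) :
    Measurable fun q : Z × (Fin n → Y) => seqProd (f q.1) q.2 := by
  unfold seqProd
  refine Finset.measurable_prod _ fun t _ => ?_
  exact (hf t).comp (measurable_fst.prodMk ((measurable_pi_lambda _ fun j =>
    (measurable_pi_apply _).comp measurable_snd).prodMk
      ((measurable_pi_apply _).comp measurable_snd)))

lemma measurable_seqProd' [CommMonoid M] [MeasurableSpace M] [MeasurableMul₂ M]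
    {f : ∀ t : Fin n, (Fin t → Y) → Y → M}
    (hf : ∀ t : Fin n, Measurable fun q : (Fin t → Y) × Y => f t q.1 q.2) :
    Measurable (seqProd f) :=
  (measurable_seqProd (Z := Unit) (f := fun _ => f) fun t => (hf t).comp measurable_snd).comp
    (measurable_const.prodMk measurable_id : Measurable fun y => ((), y))

lemma measurable_seqTail [MeasurableSpace M] {f : ∀ t : Fin (n + 1), (Fin t → Y) → Y → M}
    (hf : ∀ t : Fin _, Measurable fun q : (Fin t → Y) × Y => f t q.1 q.2) (t : Fin n) :
    Measurable fun q : Y × (Fin t → Y) × Y => seqTail f q.1 t q.2.1 q.2.2 :=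
  (hf t.succ).comp ((measurable_cons.comp
    (measurable_fst.prodMk (measurable_fst.comp measurable_snd))).prodMk
      (measurable_snd.comp measurable_snd))

variable (μ : Measure Y) [SigmaFinite μ]

lemma lintegral_pi_fin_succ {G : (Fin (n + 1) → Y) → ℝ≥0∞} (hG : Measurable G) :
    ∫⁻ y, G y ∂(Measure.pi fun _ : Fin (n + 1) => μ) =
      ∫⁻ b, ∫⁻ y, G (Fin.cons (α := fun _ => Y) b y) ∂(Measure.pi fun _ : Fin n => μ) ∂μ := by
  have h := (measurePreserving_piFinSuccAbove (fun _ : Fin (n + 1) => μ) 0).symm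
  rw [← h.lintegral_comp hG, lintegral_prod]
  · simp [MeasurableEquiv.piFinSuccAbove, Fin.insertNthEquiv, Fin.insertNth_zero']
  · exact (hG.comp h.measurable).aemeasurable

/-- Successive factors may be changed almost everywhere. -/
lemma lintegral_seqProd_mul_congr :
    ∀ (n : ℕ) (f g : ∀ t : Fin n, (Fin t → Y) → Y → ℝ≥0∞)
      (_ : ∀ t : Fin _, Measurable fun q : (Fin t → Y) × Y => f t q.1 q.2)
      (_ : ∀ t : Fin _, Measurable fun q : (Fin t → Y) × Y => g t q.1 q.2)
      (_ : ∀ t h, f t h =ᵐ[μ] g t h) (H : (Fin n → Y) → ℝ≥0∞) (_ : Measurable H),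
      ∫⁻ y, seqProd f y * H y ∂(Measure.pi fun _ : Fin n => μ) =
        ∫⁻ y, seqProd g y * H y ∂(Measure.pi fun _ : Fin n => μ)
  | 0, f, g, _, _, _, H, _ => by simp [seqProd]
  | n + 1, f, g, hf, hg, hfg, H, hH => by
    have mF := measurable_seqProd' hf
    have mG := measurable_seqProd' hg
    rw [lintegral_pi_fin_succ μ (by fun_prop), lintegral_pi_fin_succ μ (by fun_prop)]
    refine lintegral_congr_ae ?_
    -- The exceptional null set depends on the history, so it is discarded one message at a time.
    filter_upwards [hfg 0 emptyHistory] with b hb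
    simp only [seqProd_cons, hb, mul_assoc]
    have mc : Measurable fun y : Fin n → Y => (Fin.cons (α := fun _ => Y) b y : Fin (n + 1) → Y) :=
      measurable_cons.comp (measurable_const.prodMk measurable_id)
    have mt : ∀ t : Fin n, Measurable fun q : (Fin t → Y) × Y => ((b, q) : Y × (Fin t → Y) × Y) :=
      fun t => measurable_const.prodMk measurable_id
    have mf' : ∀ t : Fin _, Measurable fun q : (Fin t → Y) × Y => seqTail f b t q.1 q.2 :=
      fun t => (measurable_seqTail hf t).comp (mt t)
    have mg' : ∀ t : Fin _, Measurable fun q : (Fin t → Y) × Y => seqTail g b t q.1 q.2 :=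
      fun t => (measurable_seqTail hg t).comp (mt t)
    have mH := hH.comp mc
    have mF' : Measurable fun y => seqProd (seqTail f b) y * H (Fin.cons (α := fun _ => Y) b y) :=
      (measurable_seqProd' mf').mul mH
    have mG' : Measurable fun y => seqProd (seqTail g b) y * H (Fin.cons (α := fun _ => Y) b y) :=
      (measurable_seqProd' mg').mul mH
    rw [lintegral_const_mul _ mF', lintegral_const_mul _ mG']
    congr 1
    exact lintegral_seqProd_mul_congr n _ _ mf' mg' (fun t h => hfg t.succ _) _ mH

end SeqProd

/-! ### The chain rule inequality for the potential `1 / (1 + L)` -/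

/-- Tangent-line bound for `r ↦ 1/(1+Lr)` at `r = 1`, with the slope term moved across so that no
subtraction occurs in `ℝ≥0`. The exact remainder is `(r-1)² L² / ((1+L)²(1+Lr))`, at most `(r-1)²`.
-/
lemma inv_one_add_mul_le (L r : ℝ≥0) :
    (1 + L * r)⁻¹ + L * ((1 + L) ^ 2)⁻¹ * r ≤
      (1 + L)⁻¹ + L * ((1 + L) ^ 2)⁻¹ + Real.toNNReal ((r - 1 : ℝ) ^ 2) := by
  rw [← NNReal.coe_le_coe]
  push_cast
  rw [Real.coe_toNNReal _ (sq_nonneg _)]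
  have hL := L.2
  have hr := r.2
  set l : ℝ := (L : ℝ)
  set x : ℝ := (r : ℝ)
  have hl : 0 ≤ l := hL
  have hx : 0 ≤ x := hr
  have h1 : 0 < 1 + l := by positivity
  have h2 : 0 < 1 + l * x := by positivity
  have key : (1 + l)⁻¹ + l * ((1 + l) ^ 2)⁻¹ + (x - 1) ^ 2 -
      ((1 + l * x)⁻¹ + l * ((1 + l) ^ 2)⁻¹ * x) =
      (x - 1) ^ 2 * (((1 + l) ^ 2 * (1 + l * x) - l ^ 2) / ((1 + l) ^ 2 * (1 + l * x))) := by
    field_simp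
    ring
  have : 0 ≤ (1 + l) ^ 2 * (1 + l * x) - l ^ 2 := by
    have : (1 + l) ^ 2 * (1 + l * x) - l ^ 2 = 1 + 2 * l + (1 + l) ^ 2 * (l * x) := by ring
    rw [this]; positivity
  have : 0 ≤ (x - 1) ^ 2 * (((1 + l) ^ 2 * (1 + l * x) - l ^ 2) / ((1 + l) ^ 2 * (1 + l * x))) := by
    positivity
  linarith

/-- Since `f` and `f * r` both integrate to one, the linear term of the tangent-line bound
contributes the same constant to both sides. -/
lemma lintegral_potential_step {Y : Type*} [MeasurableSpace Y] {μ : Measure Y}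
    {f r : Y → ℝ≥0} (hf : Measurable f) (hr : Measurable r)
    (h1 : ∫⁻ b, (f b : ℝ≥0∞) ∂μ = 1) (h2 : ∫⁻ b, ((f b * r b : ℝ≥0) : ℝ≥0∞) ∂μ = 1) (L : ℝ≥0) :
    ∫⁻ b, ((f b * (1 + L * r b)⁻¹ : ℝ≥0) : ℝ≥0∞) ∂μ ≤
      ((1 + L)⁻¹ : ℝ≥0) + ∫⁻ b, ((f b * Real.toNNReal ((r b - 1 : ℝ) ^ 2) : ℝ≥0) : ℝ≥0∞) ∂μ := by
  -- Minus the slope of the tangent; it is finite, so adding it to both sides can be undone at the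
  -- end.
  set c : ℝ≥0 := L * ((1 + L) ^ 2)⁻¹
  have hle : ∫⁻ b, ((f b * (1 + L * r b)⁻¹ : ℝ≥0) : ℝ≥0∞) ∂μ + c ≤
      (((1 + L)⁻¹ : ℝ≥0) + ∫⁻ b, ((f b * Real.toNNReal ((r b - 1 : ℝ) ^ 2) : ℝ≥0) : ℝ≥0∞) ∂μ)
        + c := by
    calc ∫⁻ b, ((f b * (1 + L * r b)⁻¹ : ℝ≥0) : ℝ≥0∞) ∂μ + c
        = ∫⁻ b, ((f b * (1 + L * r b)⁻¹ : ℝ≥0) : ℝ≥0∞) + c * ((f b * r b : ℝ≥0) : ℝ≥0∞) ∂μ := by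
          rw [lintegral_add_left (by fun_prop), lintegral_const_mul _ (by fun_prop), h2, mul_one]
      _ ≤ ∫⁻ b, (((1 + L)⁻¹ + c : ℝ≥0) : ℝ≥0∞) * (f b : ℝ≥0∞) +
            ((f b * Real.toNNReal ((r b - 1 : ℝ) ^ 2) : ℝ≥0) : ℝ≥0∞) ∂μ := by
          refine lintegral_mono fun b => ?_
          have := mul_le_mul_right (inv_one_add_mul_le L (r b)) (f b)
          have h : f b * (1 + L * r b)⁻¹ + c * (f b * r b) ≤
              ((1 + L)⁻¹ + c) * f b + f b * Real.toNNReal ((r b - 1 : ℝ) ^ 2) :=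
            calc f b * (1 + L * r b)⁻¹ + c * (f b * r b)
                = f b * ((1 + L * r b)⁻¹ + c * r b) := by ring
              _ ≤ f b * ((1 + L)⁻¹ + c + Real.toNNReal ((r b - 1 : ℝ) ^ 2)) := this
              _ = ((1 + L)⁻¹ + c) * f b + f b * Real.toNNReal ((r b - 1 : ℝ) ^ 2) := by ring
          simpa only [ENNReal.coe_add, ENNReal.coe_mul] using ENNReal.coe_le_coe.2 h
      _ = _ := by
          rw [lintegral_add_left (by fun_prop), lintegral_const_mul _ (by fun_prop), h1, mul_one]
          push_cast
          ring
  exact (ENNReal.add_le_add_iff_right ENNReal.coe_ne_top).1 hle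

/-- If each factor `f t h` is a probability density, each `r i t h` is a likelihood ratio with
respect to it, and the sum over `i` of the chi-square divergences is at most `C t`, then the
potential `1 / (1 + L)`, summed over `i`, increases by at most `∑ t, C t`. -/
lemma sum_lintegral_potential_le {Y ι : Type*} [MeasurableSpace Y] (μ : Measure Y) [SigmaFinite μ]
    [Fintype ι] :
    ∀ (n : ℕ) (f : ∀ t : Fin n, (Fin t → Y) → Y → ℝ≥0)
      (r : ι → ∀ t : Fin n, (Fin t → Y) → Y → ℝ≥0) (C : Fin n → ℝ≥0∞)
      (_ : ∀ t : Fin _, Measurable fun q : (Fin t → Y) × Y => f t q.1 q.2)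
      (_ : ∀ i, ∀ t : Fin _, Measurable fun q : (Fin t → Y) × Y => r i t q.1 q.2)
      (_ : ∀ t h, ∫⁻ b, (f t h b : ℝ≥0∞) ∂μ = 1)
      (_ : ∀ i t h, ∫⁻ b, ((f t h b * r i t h b : ℝ≥0) : ℝ≥0∞) ∂μ = 1)
      (_ : ∀ t h, ∑ i, ∫⁻ b,
        ((f t h b * Real.toNNReal ((r i t h b - 1 : ℝ) ^ 2) : ℝ≥0) : ℝ≥0∞) ∂μ ≤ C t)
      (L : ι → ℝ≥0),
      ∑ i, ∫⁻ y, ((seqProd f y * (1 + L i * seqProd (r i) y)⁻¹ : ℝ≥0) : ℝ≥0∞)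
          ∂(Measure.pi fun _ : Fin n => μ) ≤
        ∑ i, (((1 + L i)⁻¹ : ℝ≥0) : ℝ≥0∞) + ∑ t, C t
  | 0, f, r, C, _, _, _, _, _, L => by
    simp [seqProd]
  | n + 1, f, r, C, mf, mr, h1, h2, hC, L => by
    have mE := measurable_seqProd' mf
    have mR := fun i => measurable_seqProd' (mr i)
    have mf0 : Measurable (f 0 emptyHistory) :=
      (mf 0).comp (measurable_const.prodMk measurable_id)
    have mr0 : ∀ i, Measurable (r i 0 emptyHistory) :=
      fun i => (mr i 0).comp (measurable_const.prodMk measurable_id)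
    have mft := measurable_seqProd (measurable_seqTail mf)
    have mrt := fun i => measurable_seqProd (measurable_seqTail (mr i))
    -- The expected final potential given the first message `b`. The weight `L i` has become `L i *
    -- r i 0 emptyHistory b`, which is why the induction runs over all weights.
    set A : ι → Y → ℝ≥0∞ := fun i b => ∫⁻ y, ((seqProd (seqTail f b) y *
      (1 + L i * r i 0 emptyHistory b * seqProd (seqTail (r i) b) y)⁻¹ : ℝ≥0) : ℝ≥0∞)
        ∂(Measure.pi fun _ : Fin n => μ) with hA
    have mA : ∀ i, Measurable (A i) := fun i => by
      have := mrt i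
      have := mr0 i
      refine Measurable.lintegral_prod_right' (f := fun q : Y × (Fin n → Y) =>
        ((seqProd (seqTail f q.1) q.2 * (1 + L i * r i 0 emptyHistory q.1 *
          seqProd (seqTail (r i) q.1) q.2)⁻¹ : ℝ≥0) : ℝ≥0∞)) ?_
      fun_prop
    have hstep : ∀ i, ∫⁻ y, ((seqProd f y * (1 + L i * seqProd (r i) y)⁻¹ : ℝ≥0) : ℝ≥0∞)
          ∂(Measure.pi fun _ : Fin (n + 1) => μ) =
        ∫⁻ b, (f 0 emptyHistory b : ℝ≥0∞) * A i b ∂μ := fun i => by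
      have := mR i
      rw [lintegral_pi_fin_succ μ (by fun_prop)]
      refine lintegral_congr fun b => ?_
      rw [hA, ← lintegral_const_mul' _ _ ENNReal.coe_ne_top]
      refine lintegral_congr fun y => ?_
      rw [seqProd_cons, seqProd_cons, ← ENNReal.coe_mul]
      congr 1
      ring
    have hind : ∀ b, ∑ i, A i b ≤
        ∑ i, (((1 + L i * r i 0 emptyHistory b)⁻¹ : ℝ≥0) : ℝ≥0∞) + ∑ t : Fin n, C t.succ := by
      intro b
      have mt : ∀ t : Fin n, Measurable fun q : (Fin t → Y) × Y =>
          ((b, q) : Y × (Fin t → Y) × Y) := fun t => measurable_const.prodMk measurable_id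
      exact sum_lintegral_potential_le μ n (seqTail f b) (fun i => seqTail (r i) b)
        (fun t => C t.succ) (fun t => (measurable_seqTail mf t).comp (mt t))
        (fun i t => (measurable_seqTail (mr i) t).comp (mt t)) (fun t h => h1 t.succ _)
        (fun i t h => h2 i t.succ _) (fun t h => hC t.succ _)
        (fun i => L i * r i 0 emptyHistory b)
    calc _ = ∫⁻ b, (f 0 emptyHistory b : ℝ≥0∞) * ∑ i, A i b ∂μ := by
          simp_rw [hstep, Finset.mul_sum]
          rw [lintegral_finsetSum _ fun i _ => by have := mA i; fun_prop]
      _ ≤ ∫⁻ b, (∑ i, ((f 0 emptyHistory b *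
            (1 + L i * r i 0 emptyHistory b)⁻¹ : ℝ≥0) : ℝ≥0∞)) +
            f 0 emptyHistory b * ∑ t : Fin n, C t.succ ∂μ := by
          refine lintegral_mono fun b => (mul_le_mul_right (hind b) _).trans (le_of_eq ?_)
          rw [mul_add, Finset.mul_sum]
          simp_rw [ENNReal.coe_mul]
      _ = (∑ i, ∫⁻ b, ((f 0 emptyHistory b *
            (1 + L i * r i 0 emptyHistory b)⁻¹ : ℝ≥0) : ℝ≥0∞) ∂μ) +
            ∑ t : Fin n, C t.succ := by
          rw [lintegral_add_right _ (by fun_prop), lintegral_mul_const _ (by fun_prop), h1, one_mul,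
            lintegral_finsetSum _ fun i _ => by have := mr0 i; fun_prop]
      _ ≤ (∑ i, ((((1 + L i)⁻¹ : ℝ≥0) : ℝ≥0∞) + ∫⁻ b, ((f 0 emptyHistory b *
            Real.toNNReal ((r i 0 emptyHistory b - 1 : ℝ) ^ 2) : ℝ≥0) : ℝ≥0∞) ∂μ)) +
            ∑ t : Fin n, C t.succ := by
          gcongr with i
          exact lintegral_potential_step mf0 (mr0 i) (h1 _ _) (h2 _ _ _) _
      _ ≤ _ := by
          rw [Finset.sum_add_distrib, add_assoc, Fin.sum_univ_succ]
          gcongr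
          exact hC 0 _

end InfoContraction
namespace InfoContraction

/-! ### Total variation and the triangular discrimination -/

lemma integral_coe_nnreal {S : Type*} [MeasurableSpace S] {ν : Measure S} {L : S → ℝ≥0}
    (hL : Measurable L) : ∫ x, (L x : ℝ) ∂ν = (∫⁻ x, (L x : ℝ≥0∞) ∂ν).toReal := by
  rw [integral_eq_lintegral_of_nonneg_ae
    (Filter.Eventually.of_forall fun x => NNReal.coe_nonneg _) (by fun_prop)]
  simp only [ENNReal.ofReal_coe_nnreal]

lemma integrable_coe_nnreal {S : Type*} [MeasurableSpace S] {ν : Measure S} {L : S → ℝ≥0}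
    (hL : Measurable L) (h : ∫⁻ x, (L x : ℝ≥0∞) ∂ν ≠ ∞) : Integrable (fun x => (L x : ℝ)) ν := by
  refine ⟨by fun_prop, ?_⟩
  rw [hasFiniteIntegral_iff_ofReal (Filter.Eventually.of_forall fun x => NNReal.coe_nonneg _)]
  simpa only [ENNReal.ofReal_coe_nnreal] using h.lt_top

/-- The linearised bound of the total variation distance of `ν` and `L • ν` by the triangular
discrimination `∫ (1 - L)² / (1 + L) ∂ν = 4 ∫ 1 / (1 + L) ∂ν - 2`. -/
lemma abs_real_sub_withDensity_real_le {S : Type*} [MeasurableSpace S] {ν : Measure S}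
    [IsProbabilityMeasure ν] {L : S → ℝ≥0} (hL : Measurable L)
    (h1 : ∫⁻ x, (L x : ℝ≥0∞) ∂ν = 1) {A : Set S} (hA : MeasurableSet A) {ε : ℝ} (hε : 0 < ε) :
    |ν.real A - (ν.withDensity fun x => (L x : ℝ≥0∞)).real A| ≤
      ε / 2 + (4 * (∫⁻ x, (((1 + L x)⁻¹ : ℝ≥0) : ℝ≥0∞) ∂ν).toReal - 2) / (4 * ε) := by
  have iL : Integrable (fun x => (L x : ℝ)) ν := integrable_coe_nnreal hL (by simp [h1])
  have eL : ∫ x, (L x : ℝ) ∂ν = 1 := by simp [integral_coe_nnreal hL, h1]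
  have hV : Measurable fun x => (1 + L x)⁻¹ := by fun_prop
  have iV : Integrable (fun x => (((1 + L x)⁻¹ : ℝ≥0) : ℝ)) ν := by
    refine Integrable.of_bound (C := 1) (by fun_prop) (Filter.Eventually.of_forall fun x => ?_)
    rw [Real.norm_of_nonneg (NNReal.coe_nonneg _)]
    push_cast
    exact inv_le_one_of_one_le₀ (by linarith [(L x).2])
  have eV := integral_coe_nnreal (ν := ν) hV
  have e1 : ν.real A = ∫ x, A.indicator (fun _ => (1 : ℝ)) x ∂ν := by
    rw [integral_indicator hA]; simp
  have e2 : (ν.withDensity fun x => (L x : ℝ≥0∞)).real A =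
      ∫ x, A.indicator (fun x => (L x : ℝ)) x ∂ν := by
    rw [integral_indicator hA, integral_coe_nnreal hL, Measure.real, withDensity_apply _ hA]
  have i1 : Integrable (A.indicator fun _ => (1 : ℝ)) ν := (integrable_const _).indicator hA
  have i2 := iL.indicator hA
  -- Subtracting half of `∫ (1 - L) = 0` turns the indicator of `A` into `±1/2`, which gains a
  -- factor two in the pointwise bound.
  have e3 : ν.real A - (ν.withDensity fun x => (L x : ℝ≥0∞)).real A =
      ∫ x, (A.indicator (fun _ => (1 : ℝ)) x - A.indicator (fun x => (L x : ℝ)) x) -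
        (1 / 2) * (1 - (L x : ℝ)) ∂ν := by
    have i3 : Integrable (fun x => 1 - (L x : ℝ)) ν := (integrable_const _).sub iL
    have e4 : ∫ x, 1 - (L x : ℝ) ∂ν = 0 := by
      rw [integral_sub (integrable_const _) iL, eL]; simp
    rw [integral_sub (by exact i1.sub i2) (i3.const_mul _), integral_sub i1 i2,
      integral_const_mul, e4, e1, e2]
    simp
  rw [e3]
  -- The last factor is `(1-L)²/(1+L)`. Pointwise this is the AM-GM inequality, whose defect is a
  -- square divided by `4ε(1+L)`.
  calc _ ≤ ∫ x, ε / 4 * (1 + (L x : ℝ)) +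
        1 / (4 * ε) * ((L x : ℝ) - 3 + 4 * (((1 + L x)⁻¹ : ℝ≥0) : ℝ)) ∂ν := by
        rw [← Real.norm_eq_abs]
        refine norm_integral_le_of_norm_le ?_ (Filter.Eventually.of_forall fun x => ?_)
        · exact (((integrable_const _).add iL).const_mul _).add
            (((iL.sub (integrable_const _)).add (iV.const_mul _)).const_mul _)
        · have hx : (0 : ℝ) ≤ L x := (L x).2
          push_cast
          set l : ℝ := (L x : ℝ)
          have hs : 0 < 1 + l := by positivity
          have hkey : |1 - l| / 2 ≤ ε / 4 * (1 + l) + 1 / (4 * ε) * (l - 3 + 4 * (1 + l)⁻¹) := by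
            have : ε / 4 * (1 + l) + 1 / (4 * ε) * (l - 3 + 4 * (1 + l)⁻¹) - |1 - l| / 2 =
                (ε * (1 + l) - |1 - l|) ^ 2 / (4 * ε * (1 + l)) := by
              have h := sq_abs (1 - l)
              field_simp
              linear_combination (-2 : ℝ) * h
            have : 0 ≤ (ε * (1 + l) - |1 - l|) ^ 2 / (4 * ε * (1 + l)) := by positivity
            linarith
          refine le_trans (le_of_eq ?_) hkey
          by_cases hxA : x ∈ A
          · simp only [hxA, Set.indicator_of_mem, Real.norm_eq_abs]
            rw [show (1 : ℝ) - l - 1 / 2 * (1 - l) = (1 - l) / 2 by ring, abs_div, abs_two]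
          · simp only [hxA, not_false_eq_true, Set.indicator_of_notMem, Real.norm_eq_abs]
            rw [show (0 : ℝ) - 0 - 1 / 2 * (1 - l) = -((1 - l) / 2) by ring, abs_neg, abs_div,
              abs_two]
    _ = _ := by
        rw [integral_add, integral_const_mul, integral_const_mul,
          integral_add (integrable_const _) iL, integral_add, integral_sub iL (integrable_const _),
          integral_const_mul, eL, eV]
        · simp
          field_simp
          ring
        · exact iL.sub (integrable_const _)
        · exact iV.const_mul _
        · exact ((integrable_const _).add iL).const_mul _
        · exact ((iL.sub (integrable_const _)).add (iV.const_mul _)).const_mul _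

end InfoContraction
namespace InfoContraction

/-! ### The average discrepancy -/

instance : MeasurableSingletonClass ℤˣ where
  measurableSet_singleton s := ⟨{(s : ℤ)}, measurableSet_singleton _, by ext; simp [Units.ext_iff]⟩

lemma rademacher_singleton_one (τ : ℝ) : rademacher τ {1} = ENNReal.ofReal τ := by
  have h : (-1 : ℤˣ) ∉ ({1} : Set ℤˣ) := by decide
  simp [rademacher, h]

lemma rademacher_singleton_neg_one (τ : ℝ) : rademacher τ {-1} = ENNReal.ofReal (1 - τ) := by
  have h : (1 : ℤˣ) ∉ ({-1} : Set ℤˣ) := by decide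
  simp [rademacher, h]

lemma isProbabilityMeasure_rademacher {τ : ℝ} (h0 : 0 ≤ τ) (h1 : τ ≤ 1) :
    IsProbabilityMeasure (rademacher τ) := by
  constructor
  simp only [rademacher, Measure.add_apply, Measure.smul_apply, measure_univ, smul_eq_mul, mul_one]
  rw [← ENNReal.ofReal_add h0 (by linarith)]
  simp

variable {k : ℕ}

lemma flipCoord_flipCoord (z : Cube k) (i : Fin k) : flipCoord (flipCoord z i) i = z := by
  simp [flipCoord]

lemma flipCoord_apply_self (z : Cube k) (i : Fin k) : flipCoord z i i = -z i := by
  simp [flipCoord]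

lemma cubeLaw_real_singleton {τ : ℝ} (h0 : 0 ≤ τ) (h1 : τ ≤ 1) (z : Cube k) :
    (cubeLaw τ k).real {z} = ∏ j, (rademacher τ).real {z j} := by
  have := isProbabilityMeasure_rademacher h0 h1
  rw [cubeLaw, Measure.real, Measure.pi_singleton, ENNReal.toReal_prod]
  rfl

lemma rademacher_real_add_neg {τ : ℝ} (h0 : 0 ≤ τ) (h1 : τ ≤ 1) (s : ℤˣ) :
    (rademacher τ).real {s} + (rademacher τ).real {-s} = 1 := by
  rcases Int.units_eq_one_or s with rfl | rfl
  · simp [Measure.real, rademacher_singleton_one, rademacher_singleton_neg_one, h0, h1]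
  · simp [Measure.real, rademacher_singleton_one, rademacher_singleton_neg_one, h0, h1]

/-- The two masses differ only in their `i`-th factors, which sum to one. Hence the conditional
weight of `z` given its `i`-th coordinate is the sum of the masses of `z` and of its flip. -/
lemma cubeLaw_real_add_flip {τ : ℝ} (h0 : 0 < τ) (h1 : τ < 1) (z : Cube k) (i : Fin k) :
    (cubeLaw τ k).real {z} + (cubeLaw τ k).real {flipCoord z i} =
      (cubeLaw τ k).real {z} / (rademacher τ).real {z i} := by
  rw [cubeLaw_real_singleton h0.le h1.le, cubeLaw_real_singleton h0.le h1.le,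
    ← Finset.mul_prod_erase _ _ (Finset.mem_univ i),
    ← Finset.mul_prod_erase Finset.univ (fun j => (rademacher τ).real {flipCoord z i j})
      (Finset.mem_univ i), flipCoord_apply_self]
  have hr : ∏ j ∈ Finset.univ.erase i, (rademacher τ).real {flipCoord z i j} =
      ∏ j ∈ Finset.univ.erase i, (rademacher τ).real {z j} :=
    Finset.prod_congr rfl fun j hj => by
      rw [flipCoord, Function.update_of_ne (Finset.ne_of_mem_erase hj)]
  have hpos : (rademacher τ).real {z i} ≠ 0 := by
    have h1' : 0 < 1 - τ := by linarith
    rcases Int.units_eq_one_or (z i) with h | h <;> rw [h]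
    · simp [Measure.real, rademacher_singleton_one, h0.le, h0.ne']
    · simp [Measure.real, rademacher_singleton_neg_one, h1'.le, h1'.ne']
  rw [hr, ← add_mul, rademacher_real_add_neg h0.le h1.le, mul_div_right_comm, div_self hpos]

lemma cond_cubeLaw_real_singleton {τ : ℝ} (h0 : 0 ≤ τ) (h1 : τ ≤ 1) (z : Cube k) (i : Fin k)
    (s : ℤˣ) :
    (ProbabilityTheory.cond (cubeLaw τ k) {z' | z' i = s}).real {z} =
      if z i = s then (cubeLaw τ k).real {z} / (rademacher τ).real {z i} else 0 := by
  have := isProbabilityMeasure_rademacher h0 h1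
  have hm : MeasurableSet {z' : Cube k | z' i = s} := (Set.toFinite _).measurableSet
  have hs : cubeLaw τ k {z' | z' i = s} = rademacher τ {s} := by
    have := (measurePreserving_eval (fun _ : Fin k => rademacher τ) i).measure_preimage
      (measurableSet_singleton s).nullMeasurableSet
    exact this
  rw [Measure.real, cond_apply hm, hs]
  split_ifs with h
  · have : {z' : Cube k | z' i = s} ∩ {z} = {z} := by
      ext x; simp only [Set.mem_inter_iff, Set.mem_ofPred_eq, Set.mem_singleton_iff]
      exact ⟨fun hx => hx.2, fun hx => ⟨hx ▸ h, hx⟩⟩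
    rw [this, ENNReal.toReal_mul, ENNReal.toReal_inv, h, mul_comm, div_eq_mul_inv]
    rfl
  · have : {z' : Cube k | z' i = s} ∩ {z} = ∅ := by
      ext x; simp only [Set.mem_inter_iff, Set.mem_ofPred_eq, Set.mem_singleton_iff,
        Set.mem_empty_iff_false, iff_false]
      rintro ⟨hx, rfl⟩
      exact h hx
    simp [this]

lemma condMixture_real {S : Type*} [MeasurableSpace S] (τ : ℝ) (Q : Cube k → Measure S)
    [∀ z, IsFiniteMeasure (Q z)] (i : Fin k) (s : ℤˣ) (A : Set S) :
    (condMixture τ Q i s).real A =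
      ∑ z, (ProbabilityTheory.cond (cubeLaw τ k) {z' | z' i = s}).real {z} * (Q z).real A := by
  rw [condMixture, Measure.real, Measure.finsetSum_apply, ENNReal.toReal_sum]
  · simp [Measure.real]
  · intro z _
    exact ENNReal.mul_ne_top (measure_ne_top _ _) (measure_ne_top _ _)

/-- Writing each conditional weight as the mass of `z` plus that of its flip and reindexing the
second part by the flip pairs each law with its neighbour. No factor depending on `τ` is lost. -/
lemma condMixture_real_sub {S : Type*} [MeasurableSpace S] {τ : ℝ} (h0 : 0 < τ) (h1 : τ < 1)
    (Q : Cube k → Measure S) [∀ z, IsFiniteMeasure (Q z)] (i : Fin k) (A : Set S) :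
    (condMixture τ Q i 1).real A - (condMixture τ Q i (-1)).real A =
      ∑ z, (cubeLaw τ k).real {z} * ((z i : ℤ) : ℝ) *
        ((Q z).real A - (Q (flipCoord z i)).real A) := by
  have hflip : ∑ z, (cubeLaw τ k).real {z} * ((z i : ℤ) : ℝ) * (Q (flipCoord z i)).real A =
      ∑ z, (cubeLaw τ k).real {flipCoord z i} * (-((z i : ℤ) : ℝ)) * (Q z).real A := by
    rw [← Equiv.sum_comp (Function.Involutive.toPerm (fun z : Cube k => flipCoord z i)
      fun z => flipCoord_flipCoord z i)]
    refine Finset.sum_congr rfl fun z _ => ?_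
    change (cubeLaw τ k).real {flipCoord z i} * ((flipCoord z i i : ℤ) : ℝ) *
      (Q (flipCoord (flipCoord z i) i)).real A = _
    simp [flipCoord_flipCoord, flipCoord_apply_self]
  simp_rw [mul_sub]
  rw [Finset.sum_sub_distrib, hflip, condMixture_real, condMixture_real,
    ← Finset.sum_sub_distrib, ← Finset.sum_sub_distrib]
  refine Finset.sum_congr rfl fun z _ => ?_
  rw [cond_cubeLaw_real_singleton h0.le h1.le, cond_cubeLaw_real_singleton h0.le h1.le,
    ← cubeLaw_real_add_flip h0 h1]
  rcases Int.units_eq_one_or (z i) with h | h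
  · have : (1 : ℤˣ) ≠ -1 := by decide
    simp only [h, if_true, this, if_false]
    push_cast
    ring
  · have : (-1 : ℤˣ) ≠ 1 := by decide
    simp only [h, if_true, this, if_false]
    push_cast
    ring

/-- If the total variation distances between `Q z` and `Q (z^{⊕ i})` sum over `i` to at most `B`
for every `z`, then the average discrepancy is at most `B / k`. -/
lemma avgDiscrepancy_le {S : Type*} [MeasurableSpace S] {τ : ℝ} (h0 : 0 < τ) (h1 : τ < 1)
    (Q : Cube k → Measure S) [∀ z, IsFiniteMeasure (Q z)] (b : Cube k → Fin k → ℝ) {B : ℝ}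
    (hb : ∀ z i A, MeasurableSet A → |(Q z).real A - (Q (flipCoord z i)).real A| ≤ b z i)
    (hB : ∀ z, ∑ i, b z i ≤ B) : avgDiscrepancy τ Q ≤ 1 / k * B := by
  have := isProbabilityMeasure_rademacher h0.le h1.le
  have hprob : IsProbabilityMeasure (cubeLaw τ k) := by unfold cubeLaw; infer_instance
  have htv : ∀ i, tvDist (condMixture τ Q i 1) (condMixture τ Q i (-1)) ≤
      ∑ z, (cubeLaw τ k).real {z} * b z i := by
    intro i
    have : Nonempty {A : Set S // MeasurableSet A} := ⟨⟨∅, .empty⟩⟩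
    refine ciSup_le fun A => ?_
    rw [condMixture_real_sub h0 h1]
    refine (Finset.abs_sum_le_sum_abs _ _).trans (Finset.sum_le_sum fun z _ => ?_)
    have hz : |((z i : ℤ) : ℝ)| = 1 := by
      rcases Int.units_eq_one_or (z i) with h | h <;> simp [h]
    rw [abs_mul, abs_mul, hz, mul_one, abs_of_nonneg measureReal_nonneg]
    exact mul_le_mul_of_nonneg_left (hb z i A.1 A.2) measureReal_nonneg
  have hsum : ∑ z : Cube k, (cubeLaw τ k).real {z} = 1 := by
    rw [sum_measureReal_singleton]
    simp
  unfold avgDiscrepancy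
  refine mul_le_mul_of_nonneg_left ?_ (by positivity)
  calc _ ≤ ∑ i, ∑ z, (cubeLaw τ k).real {z} * b z i := Finset.sum_le_sum fun i _ => htv i
    _ = ∑ z, (cubeLaw τ k).real {z} * ∑ i, b z i := by
        rw [Finset.sum_comm]
        simp_rw [Finset.mul_sum]
    _ ≤ ∑ z, (cubeLaw τ k).real {z} * B :=
        Finset.sum_le_sum fun z _ => mul_le_mul_of_nonneg_left (hB z) measureReal_nonneg
    _ = B := by rw [← Finset.sum_mul, hsum, one_mul]

end InfoContraction
namespace InfoContraction

lemma integrable_fun_mul {X : Type*} [MeasurableSpace X] {p : Measure X} {u v : X → ℝ}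
    (hu : MemLp u 2 p) (hv : MemLp v 2 p) : Integrable (fun x => u x * v x) p :=
  hu.integrable_mul hv

/-! ### Bessel's inequality -/

/-- Expand `∫ (V - g)² ≥ 0`, where `g` is the orthogonal projection of `V` on the span of the `φ i`.
-/
lemma sum_sq_integral_mul_le {X ι : Type*} [MeasurableSpace X] [Fintype ι] [DecidableEq ι]
    {p : Measure X} {φ : ι → X → ℝ} (hφ : ∀ i, MemLp (φ i) 2 p)
    (horth : ∀ i j, ∫ x, φ i x * φ j x ∂p = if i = j then 1 else 0) {V : X → ℝ}
    (hV : MemLp V 2 p) : ∑ i, (∫ x, φ i x * V x ∂p) ^ 2 ≤ ∫ x, V x ^ 2 ∂p := by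
  set c : ι → ℝ := fun i => ∫ x, φ i x * V x ∂p with hc
  set g : X → ℝ := fun x => ∑ i, c i * φ i x with hg
  have mg : MemLp g 2 p := memLp_finsetSum _ fun i _ => (hφ i).const_mul _
  have iφg : ∀ i, ∫ x, φ i x * g x ∂p = c i := by
    intro i
    have : ∀ x, φ i x * g x = ∑ j, c j * (φ i x * φ j x) := fun x => by
      rw [hg, Finset.mul_sum]
      exact Finset.sum_congr rfl fun j _ => by ring
    simp_rw [this]
    rw [integral_finsetSum _ fun j _ => (integrable_fun_mul (hφ i) (hφ j)).const_mul _]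
    simp_rw [integral_const_mul, horth]
    simp
  have igu : ∀ u : X → ℝ, MemLp u 2 p → ∫ x, g x * u x ∂p = ∑ i, c i * ∫ x, φ i x * u x ∂p := by
    intro u hu
    have : ∀ x, g x * u x = ∑ j, c j * (φ j x * u x) := fun x => by
      rw [hg, Finset.sum_mul]
      exact Finset.sum_congr rfl fun j _ => by ring
    simp_rw [this]
    rw [integral_finsetSum _ fun j _ => (integrable_fun_mul (hφ j) hu).const_mul _]
    simp_rw [integral_const_mul]
  have h0 : 0 ≤ ∫ x, (V x - g x) ^ 2 ∂p := integral_nonneg fun x => sq_nonneg _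
  have hexp : ∀ x, (V x - g x) ^ 2 = V x ^ 2 - 2 * (g x * V x) + g x * g x := fun x => by ring
  have iVV : Integrable (fun x => V x ^ 2) p := hV.integrable_sq
  have igV : Integrable (fun x => g x * V x) p := mg.integrable_mul hV
  have igg : Integrable (fun x => g x * g x) p := mg.integrable_mul mg
  simp_rw [hexp] at h0
  rw [integral_add (by exact iVV.sub (igV.const_mul 2)) igg, integral_sub iVV (igV.const_mul 2),
    integral_const_mul, igu V hV, igu g mg] at h0
  simp_rw [iφg] at h0
  have : ∑ i, c i * ∫ x, φ i x * V x ∂p = ∑ i, c i * c i := rfl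
  rw [this] at h0
  have hsq : ∑ i, (∫ x, φ i x * V x ∂p) ^ 2 = ∑ i, c i * c i :=
    Finset.sum_congr rfl fun i _ => sq _
  linarith

/-! ### Output densities of a channel -/

namespace Channel

variable {X Y : Type*} [MeasurableSpace X] [MeasurableSpace Y] {μ : Measure Y}

/-- The density of the output of the channel `W` for an input of law `p`. -/
noncomputable def outDensity (W : Channel X μ) (p : Measure X) (y : Y) : ℝ≥0∞ :=
  ∫⁻ x, (W.density x y : ℝ≥0∞) ∂p

/-- The likelihood ratio of the outputs of the channel `W` for inputs of laws `q` and `p`. -/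
noncomputable def outRatio (W : Channel X μ) (p q : Measure X) (y : Y) : ℝ≥0 :=
  (W.outDensity q y).toNNReal / (W.outDensity p y).toNNReal

lemma measurable_density_left (W : Channel X μ) (y : Y) : Measurable fun x => W.density x y :=
  W.measurable_density.comp (measurable_id.prodMk measurable_const)

lemma measurable_density_right (W : Channel X μ) (x : X) : Measurable (W.density x) :=
  W.measurable_density.comp (measurable_const.prodMk measurable_id)

lemma measurable_outDensity (W : Channel X μ) (p : Measure X) [SFinite p] :
    Measurable (W.outDensity p) :=
  Measurable.lintegral_prod_left' (f := fun q : X × Y => (W.density q.1 q.2 : ℝ≥0∞))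
    W.measurable_density.coe_nnreal_ennreal

lemma measurable_outRatio (W : Channel X μ) (p q : Measure X) [SFinite p] [SFinite q] :
    Measurable (W.outRatio p q) :=
  (W.measurable_outDensity q).ennreal_toNNReal.div (W.measurable_outDensity p).ennreal_toNNReal

lemma lintegral_density (W : Channel X μ) (x : X) : ∫⁻ y, (W.density x y : ℝ≥0∞) ∂μ = 1 := by
  have := W.isMarkovKernel
  have h : W.kernel x Set.univ = 1 := measure_univ
  rwa [W.kernel_eq_withDensity, withDensity_apply _ .univ, Measure.restrict_univ] at h

/-- Makes the default value `x / 0 = 0` in `outRatio` harmless: the numerator vanishes there too. -/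
lemma outDensity_eq_zero (W : Channel X μ) {p q : Measure X} (hqp : q ≪ p) {y : Y}
    (h : W.outDensity p y = 0) : W.outDensity q y = 0 := by
  have hm : Measurable fun x => (W.density x y : ℝ≥0∞) :=
    (W.measurable_density_left y).coe_nnreal_ennreal
  exact (lintegral_eq_zero_iff hm).2 (hqp.ae_le ((lintegral_eq_zero_iff hm).1 h))

/-- The chi-square divergence of the outputs of the channel `W` for inputs of laws `q` and `p`. -/
noncomputable def outChiSq (W : Channel X μ) (p q : Measure X) : ℝ≥0∞ :=
  ∫⁻ y, (((W.outDensity p y).toNNReal *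
    Real.toNNReal ((W.outRatio p q y - 1 : ℝ) ^ 2) : ℝ≥0) : ℝ≥0∞) ∂μ

lemma sum_outChiSq {ι : Type*} [Fintype ι] (W : Channel X μ) (p : Measure X) [SFinite p]
    (q : ι → Measure X) [∀ i, SFinite (q i)] :
    ∑ i, W.outChiSq p (q i) = ∫⁻ y, ∑ i, (((W.outDensity p y).toNNReal *
      Real.toNNReal ((W.outRatio p (q i) y - 1 : ℝ) ^ 2) : ℝ≥0) : ℝ≥0∞) ∂μ := by
  unfold outChiSq
  rw [lintegral_finsetSum]
  intro i _
  have h1 := W.measurable_outRatio p (q i)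
  have h2 := W.measurable_outDensity p
  fun_prop

variable [SigmaFinite μ]

lemma lintegral_outDensity (W : Channel X μ) (p : Measure X) [IsProbabilityMeasure p] :
    ∫⁻ y, W.outDensity p y ∂μ = 1 := by
  unfold outDensity
  rw [lintegral_lintegral_swap (by exact
    (W.measurable_density.comp measurable_swap).coe_nnreal_ennreal.aemeasurable)]
  simp [lintegral_density]

lemma outDensity_ae_lt_top (W : Channel X μ) (p : Measure X) [IsProbabilityMeasure p] :
    ∀ᵐ y ∂μ, W.outDensity p y < ∞ :=
  ae_lt_top (W.measurable_outDensity p) (by simp [lintegral_outDensity])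

lemma coe_toNNReal_outDensity_ae (W : Channel X μ) (p : Measure X) [IsProbabilityMeasure p] :
    (fun y => ((W.outDensity p y).toNNReal : ℝ≥0∞)) =ᵐ[μ] W.outDensity p := by
  filter_upwards [W.outDensity_ae_lt_top p] with y hy using ENNReal.coe_toNNReal hy.ne

lemma outDensity_mul_outRatio_ae (W : Channel X μ) {p q : Measure X} [IsProbabilityMeasure p]
    [IsProbabilityMeasure q] (hqp : q ≪ p) :
    (fun y => (((W.outDensity p y).toNNReal * W.outRatio p q y : ℝ≥0) : ℝ≥0∞)) =ᵐ[μ]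
      W.outDensity q := by
  filter_upwards [W.outDensity_ae_lt_top p, W.outDensity_ae_lt_top q] with y hy hy'
  rw [outRatio]
  by_cases h : W.outDensity p y = 0
  · simp [h, W.outDensity_eq_zero hqp h]
  · rw [mul_div_cancel₀, ENNReal.coe_toNNReal hy'.ne]
    rw [Ne, ENNReal.toNNReal_eq_zero_iff]
    simp [h, hy.ne]

/-- The chi-square integrand of the output densities in terms of the relative perturbation
`ψ = dq/dp - 1` of the input law. -/
lemma outDensity_mul_sq_outRatio_sub_one_ae (W : Channel X μ) {p q : Measure X}
    [IsProbabilityMeasure p] [IsProbabilityMeasure q] (hqp : q ≪ p) {ψ : X → ℝ}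
    (hψ : ∀ᵐ x ∂p, (q.rnDeriv p x).toReal = 1 + ψ x) :
    ∀ᵐ y ∂μ, Integrable (fun x => (W.density x y : ℝ)) p ∧
      Integrable (fun x => ψ x * W.density x y) p ∧
      ∫ x, (W.density x y : ℝ) ∂p = (W.outDensity p y).toReal ∧
      (W.outDensity p y).toNNReal * Real.toNNReal ((W.outRatio p q y - 1 : ℝ) ^ 2) =
        Real.toNNReal ((∫ x, ψ x * W.density x y ∂p) ^ 2) / (W.outDensity p y).toNNReal := by
  filter_upwards [W.outDensity_ae_lt_top p, W.outDensity_ae_lt_top q] with y hy hy'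
  have hm := W.measurable_density_left y
  have iW : Integrable (fun x => (W.density x y : ℝ)) p := integrable_coe_nnreal hm hy.ne
  have iWq : Integrable (fun x => (W.density x y : ℝ)) q := integrable_coe_nnreal hm hy'.ne
  have eW : ∫ x, (W.density x y : ℝ) ∂p = (W.outDensity p y).toReal := integral_coe_nnreal hm
  have eWq : ∫ x, (W.density x y : ℝ) ∂q = (W.outDensity q y).toReal := integral_coe_nnreal hm
  have iR := (integrable_rnDeriv_smul_iff hqp).2 iWq
  have eR := integral_rnDeriv_smul hqp (f := fun x => (W.density x y : ℝ))
  have hae : (fun x => (q.rnDeriv p x).toReal • (W.density x y : ℝ) - W.density x y) =ᵐ[p]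
      fun x => ψ x * W.density x y := by
    filter_upwards [hψ] with x hx
    rw [hx, smul_eq_mul]
    ring
  have iψ : Integrable (fun x => ψ x * W.density x y) p := (iR.sub iW).congr hae
  have eψ : ∫ x, ψ x * W.density x y ∂p =
      (W.outDensity q y).toReal - (W.outDensity p y).toReal := by
    rw [← integral_congr_ae hae, integral_sub iR iW, eR, eW, eWq]
  refine ⟨iW, iψ, eW, ?_⟩
  rw [eψ, outRatio, ← NNReal.coe_inj]
  push_cast
  rw [Real.coe_toNNReal _ (sq_nonneg _), Real.coe_toNNReal _ (sq_nonneg _)]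
  by_cases h : W.outDensity p y = 0
  · simp [h]
  · have : (W.outDensity p y).toReal ≠ 0 := ENNReal.toReal_ne_zero.2 ⟨h, hy.ne⟩
    field_simp

/-- Each output density changes by `E[a_i φ_i W(y|X)]`. By centring, `W(y|X)` may be replaced by its
deviation from its mean; Bessel's inequality then gives the variance. -/
lemma sum_outChiSq_le_normalizedVariance {ι : Type*} [Fintype ι] [DecidableEq ι]
    (W : Channel X μ) {p : Measure X} [IsProbabilityMeasure p] {q : ι → Measure X}
    [∀ i, IsProbabilityMeasure (q i)] (hqp : ∀ i, q i ≪ p) {a : ι → ℝ} {φ : ι → X → ℝ} {α : ℝ}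
    (hψ : ∀ i, ∀ᵐ x ∂p, ((q i).rnDeriv p x).toReal = 1 + a i * φ i x)
    (ha : ∀ i, |a i| ≤ α) (hφ : ∀ i, MemLp (φ i) 2 p)
    (horth : ∀ i j, ∫ x, φ i x * φ j x ∂p = if i = j then 1 else 0) :
    ∑ i, W.outChiSq p (q i) ≤ ENNReal.ofReal (α ^ 2) * W.normalizedVariance p := by
  rw [sum_outChiSq, normalizedVariance, ← lintegral_const_mul' _ _ ENNReal.ofReal_ne_top]
  refine lintegral_mono_ae ?_
  have hall := ae_all_iff.2 fun i => W.outDensity_mul_sq_outRatio_sub_one_ae (hqp i) (hψ i)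
  filter_upwards [hall, W.outDensity_ae_lt_top p] with y hy hfin
  have hm := W.measurable_density_left y
  -- Both laws have mass one, so the product `a i * φ i` is centred; nothing is claimed about `φ i`
  -- alone, as `a i` may vanish.
  have hz : ∀ i, ∫ x, a i * φ i x ∂p = 0 := by
    intro i
    have h1 : ∫ x, ((q i).rnDeriv p x).toReal ∂p = 1 := by
      rw [Measure.integral_toReal_rnDeriv (hqp i)]; simp
    have h2 : ∫ x, ((q i).rnDeriv p x).toReal ∂p = ∫ x, 1 + a i * φ i x ∂p :=
      integral_congr_ae (hψ i)
    rw [h1, integral_add (integrable_const _)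
      (((hφ i).integrable one_le_two).const_mul _)] at h2
    simpa using h2
  have hbessel : ∑ i, ENNReal.ofReal ((∫ x, a i * φ i x * W.density x y ∂p) ^ 2) ≤
      ENNReal.ofReal (α ^ 2) * evariance (fun x => (W.density x y : ℝ)) p := by
    -- The variance may be infinite, and the right side is then infinite only when `α ≠ 0`.
    by_cases hα : α = 0
    · have ha0 : ∀ i, a i = 0 := fun i => abs_nonpos_iff.1 (hα ▸ ha i)
      simp [ha0]
    by_cases hL2 : MemLp (fun x => (W.density x y : ℝ)) 2 p
    swap
    · rw [evariance_eq_top (by fun_prop) hL2, ENNReal.mul_top]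
      · exact le_top
      · simpa using hα
    rw [← ofReal_variance hL2, ← ENNReal.ofReal_mul (sq_nonneg _),
      ← ENNReal.ofReal_sum_of_nonneg fun i _ => sq_nonneg _]
    refine ENNReal.ofReal_le_ofReal ?_
    rw [variance_eq_integral (by fun_prop)]
    set w : ℝ := ∫ x, (W.density x y : ℝ) ∂p
    have hV : MemLp (fun x => (W.density x y : ℝ) - w) 2 p := hL2.sub (memLp_const _)
    refine le_trans ?_ (mul_le_mul_of_nonneg_left (sum_sq_integral_mul_le hφ horth hV)
      (sq_nonneg α))
    rw [Finset.mul_sum]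
    refine Finset.sum_le_sum fun i _ => ?_
    have e : ∫ x, a i * φ i x * W.density x y ∂p =
        a i * ∫ x, φ i x * ((W.density x y : ℝ) - w) ∂p := by
      have h1 : ∀ x, a i * φ i x * W.density x y =
          a i * (φ i x * ((W.density x y : ℝ) - w)) + w * (a i * φ i x) := fun x => by ring
      simp_rw [h1]
      rw [integral_add ((integrable_fun_mul (hφ i) hV).const_mul _)
        ((((hφ i).integrable one_le_two).const_mul _).const_mul _), integral_const_mul,
        integral_const_mul, hz]
      ring
    rw [e, mul_pow]
    exact mul_le_mul_of_nonneg_right (sq_le_sq' (by linarith [abs_le.1 (ha i)])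
      (abs_le.1 (ha i)).2) (sq_nonneg _)
  change _ ≤ _ * (_ / W.outDensity p y)
  simp_rw [(hy _).2.2.2]
  -- Here the left side is zero because division by zero in `ℝ≥0` gives zero.
  by_cases h0 : W.outDensity p y = 0
  · simp [h0]
  have h0' : (W.outDensity p y).toNNReal ≠ 0 := by
    rw [Ne, ENNReal.toNNReal_eq_zero_iff]; simp [h0, hfin.ne]
  simp_rw [ENNReal.coe_div h0', ENNReal.coe_toNNReal hfin.ne, ENNReal.div_eq_inv_mul]
  rw [← Finset.mul_sum, mul_left_comm]
  exact mul_le_mul_right hbessel _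

end Channel

end InfoContraction
namespace InfoContraction

/-! ### The variational lower bound of the Kullback-Leibler divergence -/

/-- Fenchel-Young for `klFun`, whose convex conjugate is `exp h - 1`; it is `1 + x ≤ exp x` at `x =
h - log r`. -/
lemma mul_le_klFun_add_exp_sub_one {r : ℝ} (hr : 0 ≤ r) (h : ℝ) :
    r * h ≤ InformationTheory.klFun r + (Real.exp h - 1) := by
  rw [InformationTheory.klFun_apply]
  rcases hr.eq_or_lt with rfl | hr
  · simp [Real.exp_nonneg]
  · have h1 := Real.add_one_le_exp (h - Real.log r)
    rw [Real.exp_sub, Real.exp_log hr, le_div_iff₀ hr] at h1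
    linarith

/-- A form of the Donsker-Varadhan inequality. -/
lemma integral_le_toReal_klDiv {S : Type*} [MeasurableSpace S] {P Q : Measure S}
    [IsProbabilityMeasure P] [IsProbabilityMeasure Q] (hkl : InformationTheory.klDiv P Q ≠ ∞)
    {h : S → ℝ} (hm : Measurable h) (hi : Integrable h P)
    (he : ∫⁻ s, ENNReal.ofReal (Real.exp (h s)) ∂Q ≤ 1) :
    ∫ s, h s ∂P ≤ (InformationTheory.klDiv P Q).toReal := by
  obtain ⟨hac, hllr⟩ := InformationTheory.klDiv_ne_top_iff.1 hkl
  have iE : Integrable (fun s => Real.exp (h s)) Q := by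
    refine ⟨by fun_prop, ?_⟩
    rw [hasFiniteIntegral_iff_ofReal (Filter.Eventually.of_forall fun s => Real.exp_nonneg _)]
    exact he.trans_lt ENNReal.one_lt_top
  have eE : ∫ s, Real.exp (h s) ∂Q ≤ 1 := by
    rw [integral_eq_lintegral_of_nonneg_ae
      (Filter.Eventually.of_forall fun s => Real.exp_nonneg _) (by fun_prop)]
    exact ENNReal.toReal_le_of_le_ofReal zero_le_one (by simpa using he)
  have iK := (InformationTheory.integrable_klFun_rnDeriv_iff hac).2 hllr
  rw [InformationTheory.toReal_klDiv_eq_integral_klFun hac, ← integral_rnDeriv_smul hac]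
  have iR := (integrable_rnDeriv_smul_iff hac).2 hi
  have iE1 : Integrable (fun s => Real.exp (h s) - 1) Q := iE.sub (integrable_const _)
  have := integral_mono iR (iK.add iE1) fun s =>
    mul_le_klFun_add_exp_sub_one ENNReal.toReal_nonneg (h s)
  refine this.trans ?_
  simp only [Pi.add_apply]
  rw [integral_add iK iE1, integral_sub iE (integrable_const _)]
  simp
  linarith

/-! ### Subgaussian vectors -/

/-- Normalise `c` to a unit vector and use the subgaussian bound at parameter `‖c‖`; the zero vector
is treated apart. -/
lemma lintegral_exp_sum_le_of_subgaussian {X ι : Type*} [MeasurableSpace X] [Fintype ι]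
    {p : Measure X} [IsProbabilityMeasure p] {φ : ι → X → ℝ} {σ : ℝ≥0}
    (hsub : ∀ v : EuclideanSpace ℝ ι, ‖v‖ = 1 →
      HasSubgaussianMGF (fun x => ∑ i, v i * φ i x) (σ ^ 2) p) (c : ι → ℝ) :
    ∫⁻ x, ENNReal.ofReal (Real.exp (∑ i, c i * φ i x)) ∂p ≤
      ENNReal.ofReal (Real.exp (σ ^ 2 * (∑ i, c i ^ 2) / 2)) := by
  set u : EuclideanSpace ℝ ι := WithLp.toLp 2 c with hu
  have hn : ‖u‖ ^ 2 = ∑ i, c i ^ 2 := by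
    rw [EuclideanSpace.norm_sq_eq]
    simp [hu]
  by_cases h0 : u = 0
  · have hc : ∀ i, c i = 0 := fun i => by
      have : u i = 0 := by rw [h0]; rfl
      simpa [hu] using this
    simp [hc]
  have hpos : ‖u‖ ≠ 0 := norm_ne_zero_iff.2 h0
  have hv := hsub (‖u‖⁻¹ • u) (norm_smul_inv_norm (𝕜 := ℝ) h0)
  have hlin : ∀ x, ‖u‖ * ∑ i, (‖u‖⁻¹ • u) i * φ i x = ∑ i, c i * φ i x := fun x => by
    rw [Finset.mul_sum]
    refine Finset.sum_congr rfl fun i _ => ?_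
    simp only [PiLp.smul_apply, smul_eq_mul, hu]
    rw [← mul_assoc, mul_inv_cancel_left₀ hpos]
  have hi := hv.integrable_exp_mul ‖u‖
  have hle := hv.mgf_le ‖u‖
  simp only [mgf, hlin] at hi hle
  rw [← ofReal_integral_eq_lintegral_ofReal hi
    (Filter.Eventually.of_forall fun x => Real.exp_nonneg _)]
  refine ENNReal.ofReal_le_ofReal (hle.trans_eq ?_)
  rw [hn]
  push_cast
  rfl

/-! ### The chi-square divergence of outputs and mutual information -/

namespace Channel

variable {X Y : Type*} [MeasurableSpace X] [MeasurableSpace Y] {μ : Measure Y}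

/-- The mean of `φ` under the posterior law of the input given the output `y`. -/
noncomputable def posteriorMean (W : Channel X μ) (p : Measure X) (φ : X → ℝ) (y : Y) : ℝ :=
  (∫ x, φ x * W.density x y ∂p) / (W.outDensity p y).toReal

lemma measurable_posteriorMean (W : Channel X μ) (p : Measure X) [SFinite p] {φ : X → ℝ}
    (hφ : Measurable φ) : Measurable (W.posteriorMean p φ) := by
  refine Measurable.div ?_ (W.measurable_outDensity p).ennreal_toReal
  have h : Measurable fun q : X × Y => φ q.1 * W.density q.1 q.2 :=
    (hφ.comp measurable_fst).mul W.measurable_density.coe_nnreal_real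
  exact (h.stronglyMeasurable.integral_prod_left' (μ := p)).measurable

lemma integrable_mul_density {W : Channel X μ} {p : Measure X} {φ : X → ℝ} (hφm : Measurable φ)
    {y : Y} (hW : Integrable (fun x => (W.density x y : ℝ)) p)
    (hφ : Integrable (fun x => φ x ^ 2 * W.density x y) p) :
    Integrable (fun x => φ x * W.density x y) p := by
  have := W.measurable_density_left y
  refine Integrable.mono' (hW.add hφ) (by fun_prop) (Filter.Eventually.of_forall fun x => ?_)
  have h0 : (0 : ℝ) ≤ W.density x y := NNReal.coe_nonneg _
  rw [Real.norm_eq_abs, abs_mul, abs_of_nonneg h0]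
  have h1 : |φ x| ≤ 1 + φ x ^ 2 := by
    rw [← sq_abs]
    nlinarith [sq_nonneg (|φ x| - 1), abs_nonneg (φ x)]
  calc |φ x| * W.density x y ≤ (1 + φ x ^ 2) * W.density x y := mul_le_mul_of_nonneg_right h1 h0
    _ = _ := by simp only [Pi.add_apply]; ring

variable [SigmaFinite μ]

lemma compProd_eq_withDensity (W : Channel X μ) (p : Measure X) [IsProbabilityMeasure p] :
    p.compProd W.kernel =
      (p.prod μ).withDensity fun q => (W.density q.1 q.2 : ℝ≥0∞) := by
  have := W.isMarkovKernel
  ext s hs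
  rw [Measure.compProd_apply hs, withDensity_apply _ hs, ← lintegral_indicator hs, lintegral_prod]
  · refine lintegral_congr fun x => ?_
    have hs' : MeasurableSet (Prod.mk x ⁻¹' s) := measurable_prodMk_left hs
    rw [W.kernel_eq_withDensity, withDensity_apply _ hs', ← lintegral_indicator hs']
    rfl
  · exact (W.measurable_density.coe_nnreal_ennreal.indicator hs).aemeasurable

/-- Integrals against the joint law of input and output. -/
lemma lintegral_compProd_kernel (W : Channel X μ) (p : Measure X) [IsProbabilityMeasure p]
    {F : X × Y → ℝ≥0∞} (hF : Measurable F) :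
    ∫⁻ q, F q ∂(p.compProd W.kernel) =
      ∫⁻ y, ∫⁻ x, W.density x y * F (x, y) ∂p ∂μ := by
  rw [compProd_eq_withDensity, lintegral_withDensity_eq_lintegral_mul _
    W.measurable_density.coe_nnreal_ennreal hF, lintegral_prod_symm]
  · rfl
  · exact (W.measurable_density.coe_nnreal_ennreal.mul hF).aemeasurable

/-- By Tonelli the double integral is `E[φ²] < ∞`, since each `W(·|x)` has mass one. -/
lemma integrable_sq_mul_density_ae (W : Channel X μ) {p : Measure X} [IsProbabilityMeasure p]
    {φ : X → ℝ} (hφm : Measurable φ) (hφ : MemLp φ 2 p) :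
    ∀ᵐ y ∂μ, Integrable (fun x => φ x ^ 2 * W.density x y) p := by
  have hfin : ∫⁻ y, ∫⁻ x, W.density x y * ENNReal.ofReal (φ x ^ 2) ∂p ∂μ ≠ ∞ := by
    rw [lintegral_lintegral_swap]
    · have : ∀ x, ∫⁻ y, W.density x y * ENNReal.ofReal (φ x ^ 2) ∂μ = ENNReal.ofReal (φ x ^ 2) :=
        fun x => by
          rw [lintegral_mul_const _ (W.measurable_density_right x).coe_nnreal_ennreal,
            lintegral_density, one_mul]
      simp_rw [this]
      exact (hasFiniteIntegral_iff_ofReal (Filter.Eventually.of_forall fun x => sq_nonneg _)).1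
        hφ.integrable_sq.2 |>.ne
    · have h := (W.measurable_density.comp measurable_swap).coe_nnreal_ennreal
      exact (h.mul ((hφm.comp measurable_snd).pow_const 2).ennreal_ofReal).aemeasurable
  have hm : Measurable fun y => ∫⁻ x, W.density x y * ENNReal.ofReal (φ x ^ 2) ∂p :=
    Measurable.lintegral_prod_left' (f := fun q : X × Y =>
      (W.density q.1 q.2 : ℝ≥0∞) * ENNReal.ofReal (φ q.1 ^ 2))
      (W.measurable_density.coe_nnreal_ennreal.mul
        ((hφm.comp measurable_fst).pow_const 2).ennreal_ofReal)
  filter_upwards [ae_lt_top hm hfin] with y hy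
  have := W.measurable_density_left y
  refine ⟨by fun_prop, ?_⟩
  rw [hasFiniteIntegral_iff_ofReal (Filter.Eventually.of_forall fun x =>
    mul_nonneg (sq_nonneg _) (NNReal.coe_nonneg _))]
  refine lt_of_eq_of_lt (lintegral_congr fun x => ?_) hy
  rw [ENNReal.ofReal_mul (sq_nonneg _), ENNReal.ofReal_coe_nnreal, mul_comm]

/-- The posterior mean is a contraction: `m(y)² w(y) ≤ E[φ² W(y)]`, together with the defining
relation `m(y) w(y) = E[φ W(y)]`. -/
lemma posteriorMean_ae (W : Channel X μ) {p : Measure X} [IsProbabilityMeasure p]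
    {φ : X → ℝ} (hφm : Measurable φ) (hφ : MemLp φ 2 p) :
    ∀ᵐ y ∂μ, W.posteriorMean p φ y * (W.outDensity p y).toReal = ∫ x, φ x * W.density x y ∂p ∧
      W.posteriorMean p φ y ^ 2 * (W.outDensity p y).toReal ≤
        ∫ x, φ x ^ 2 * W.density x y ∂p := by
  filter_upwards [W.outDensity_ae_lt_top p, W.integrable_sq_mul_density_ae hφm hφ] with y hy hi
  have hm := W.measurable_density_left y
  have iW : Integrable (fun x => (W.density x y : ℝ)) p := integrable_coe_nnreal hm hy.ne
  have eW : ∫ x, (W.density x y : ℝ) ∂p = (W.outDensity p y).toReal := integral_coe_nnreal hm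
  have iφ := integrable_mul_density hφm iW hi
  have h1 : W.posteriorMean p φ y * (W.outDensity p y).toReal =
      ∫ x, φ x * W.density x y ∂p := by
    by_cases h0 : W.outDensity p y = 0
    · have hz : ∀ᵐ x ∂p, (W.density x y : ℝ≥0∞) = 0 :=
        (lintegral_eq_zero_iff hm.coe_nnreal_ennreal).1 h0
      have : (fun x => φ x * W.density x y) =ᵐ[p] fun _ => 0 := by
        filter_upwards [hz] with x hx
        simp [ENNReal.coe_eq_zero.1 hx]
      rw [integral_congr_ae this]
      simp [h0]
    · exact div_mul_cancel₀ _ (ENNReal.toReal_ne_zero.2 ⟨h0, hy.ne⟩)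
  refine ⟨h1, ?_⟩
  set m := W.posteriorMean p φ y
  -- Nonnegativity of the unnormalised posterior variance, that is, conditional Jensen.
  have h2 : 0 ≤ ∫ x, (φ x - m) ^ 2 * W.density x y ∂p :=
    integral_nonneg fun x => mul_nonneg (sq_nonneg _) (NNReal.coe_nonneg _)
  have hexp : ∀ x, (φ x - m) ^ 2 * W.density x y = φ x ^ 2 * W.density x y -
      2 * m * (φ x * W.density x y) + m ^ 2 * W.density x y := fun x => by ring
  simp_rw [hexp] at h2
  rw [integral_add (by exact hi.sub (iφ.const_mul _)) (iW.const_mul _),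
    integral_sub hi (iφ.const_mul _), integral_const_mul, integral_const_mul, ← h1, eW] at h2
  linarith

end Channel

end InfoContraction
namespace InfoContraction

/-! ### Posterior means as conditional expectations, and their control by mutual information -/

namespace Channel

variable {X Y : Type*} [MeasurableSpace X] [MeasurableSpace Y] {μ : Measure Y}

lemma memLp_comp_fst (W : Channel X μ) {p : Measure X} [IsProbabilityMeasure p]
    {φ : X → ℝ} (hφ : MemLp φ 2 p) : MemLp (fun q : X × Y => φ q.1) 2 (p.compProd W.kernel) := by
  have := W.isMarkovKernel
  exact hφ.comp_measurePreserving ⟨measurable_fst, Measure.fst_compProd p W.kernel⟩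

variable [SigmaFinite μ]

lemma integral_compProd_kernel (W : Channel X μ) (p : Measure X) [IsProbabilityMeasure p]
    {F : X × Y → ℝ} (hF : Integrable F (p.compProd W.kernel)) :
    ∫ q, F q ∂(p.compProd W.kernel) = ∫ y, ∫ x, W.density x y * F (x, y) ∂p ∂μ := by
  rw [compProd_eq_withDensity] at hF ⊢
  rw [integral_withDensity_eq_integral_smul (f := fun q : X × Y => W.density q.1 q.2)
    W.measurable_density]
  have hF' := (integrable_withDensity_iff_integrable_smul (f := fun q : X × Y => W.density q.1 q.2)
    W.measurable_density).1 hF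
  rw [integral_prod_symm _ hF']
  rfl

lemma memLp_posteriorMean (W : Channel X μ) {p : Measure X} [IsProbabilityMeasure p]
    {φ : X → ℝ} (hφm : Measurable φ) (hφ : MemLp φ 2 p) :
    MemLp (fun q : X × Y => W.posteriorMean p φ q.2) 2 (p.compProd W.kernel) := by
  have hm : Measurable fun q : X × Y => W.posteriorMean p φ q.2 :=
    (W.measurable_posteriorMean p hφm).comp measurable_snd
  refine (memLp_two_iff_integrable_sq hm.aestronglyMeasurable).2
    ⟨(hm.pow_const 2).aestronglyMeasurable, ?_⟩
  rw [hasFiniteIntegral_iff_ofReal (Filter.Eventually.of_forall fun q => sq_nonneg _)]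
  have hφ2 := (hasFiniteIntegral_iff_ofReal (Filter.Eventually.of_forall fun q => sq_nonneg _)).1
    (W.memLp_comp_fst hφ).integrable_sq.2
  refine lt_of_le_of_lt ?_ hφ2
  rw [W.lintegral_compProd_kernel p (by fun_prop),
    W.lintegral_compProd_kernel p (by fun_prop)]
  refine lintegral_mono_ae ?_
  filter_upwards [W.outDensity_ae_lt_top p, W.integrable_sq_mul_density_ae hφm hφ,
    W.posteriorMean_ae hφm hφ] with y hy hi hle
  rw [lintegral_mul_const _ (W.measurable_density_left y).coe_nnreal_ennreal]
  change W.outDensity p y * _ ≤ _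
  have e : ∫⁻ x, W.density x y * ENNReal.ofReal (φ x ^ 2) ∂p =
      ENNReal.ofReal (∫ x, φ x ^ 2 * W.density x y ∂p) := by
    rw [ofReal_integral_eq_lintegral_ofReal hi (Filter.Eventually.of_forall fun x =>
      mul_nonneg (sq_nonneg _) (NNReal.coe_nonneg _))]
    refine lintegral_congr fun x => ?_
    rw [ENNReal.ofReal_mul (sq_nonneg _), ENNReal.ofReal_coe_nnreal, mul_comm]
  rw [e, mul_comm, ← ENNReal.ofReal_toReal hy.ne, ← ENNReal.ofReal_mul (sq_nonneg _)]
  exact ENNReal.ofReal_le_ofReal hle.2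

/-- Tower property: the posterior mean is the conditional expectation of `φ(X)` given the output. -/
lemma integral_posteriorMean_mul (W : Channel X μ) {p : Measure X} [IsProbabilityMeasure p]
    {φ : X → ℝ} (hφm : Measurable φ) (hφ : MemLp φ 2 p) :
    ∫ q : X × Y, W.posteriorMean p φ q.2 * φ q.1 ∂(p.compProd W.kernel) =
      ∫ q : X × Y, W.posteriorMean p φ q.2 ^ 2 ∂(p.compProd W.kernel) := by
  rw [W.integral_compProd_kernel p (integrable_fun_mul (W.memLp_posteriorMean hφm hφ)
    (W.memLp_comp_fst hφ)), W.integral_compProd_kernel p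
    (W.memLp_posteriorMean hφm hφ).integrable_sq]
  refine integral_congr_ae ?_
  filter_upwards [W.posteriorMean_ae hφm hφ] with y hy
  have e1 : ∀ x, (W.density x y : ℝ) * (W.posteriorMean p φ y * φ x) =
      W.posteriorMean p φ y * (φ x * W.density x y) := fun x => by ring
  simp_rw [e1]
  rw [integral_const_mul, integral_mul_const, ← hy.1,
    integral_coe_nnreal (W.measurable_density_left y)]
  change _ = (W.outDensity p y).toReal * _
  ring

/-- The squared norm of the posterior mean of a subgaussian vector is controlled by the mutual
information. -/
lemma sum_integral_sq_posteriorMean_le {ι : Type*} [Fintype ι] (W : Channel X μ) {p : Measure X}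
    [IsProbabilityMeasure p] {φ : ι → X → ℝ} (hφm : ∀ i, Measurable (φ i))
    (hφ : ∀ i, MemLp (φ i) 2 p) {σ : ℝ≥0} (hσ : σ ≠ 0)
    (hsub : ∀ v : EuclideanSpace ℝ ι, ‖v‖ = 1 →
      HasSubgaussianMGF (fun x => ∑ i, v i * φ i x) (σ ^ 2) p)
    (hkl : InformationTheory.klDiv (p.compProd W.kernel) (p.prod (p.bind W.kernel)) ≠ ∞) :
    ∑ i, ∫ q : X × Y, W.posteriorMean p (φ i) q.2 ^ 2 ∂(p.compProd W.kernel) ≤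
      2 * σ ^ 2 *
        (InformationTheory.klDiv (p.compProd W.kernel) (p.prod (p.bind W.kernel))).toReal := by
  have := W.isMarkovKernel
  have hs : (0 : ℝ) < σ ^ 2 := by positivity
  set m : ι → Y → ℝ := fun i => W.posteriorMean p (φ i) with hm
  have mm : ∀ i, Measurable (m i) := fun i => W.measurable_posteriorMean p (hφm i)
  -- The Donsker-Varadhan test function is `A - B`, that is `⟨c, φ⟩ - σ²‖c‖²/2` with `c = m(y)/σ²`.
  -- This `c` maximises the posterior mean of the expression, and for every `c` its exponential has
  -- mean at most one under an independent input.
  set A : X × Y → ℝ := fun q => ∑ i, m i q.2 / σ ^ 2 * φ i q.1 with hA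
  set B : Y → ℝ := fun y => ∑ i, m i y ^ 2 / (2 * σ ^ 2) with hB
  have mA : Measurable A := by
    refine Finset.measurable_sum _ fun i _ => ?_
    exact (((mm i).comp measurable_snd).div_const _).mul ((hφm i).comp measurable_fst)
  have mB : Measurable B := Finset.measurable_sum _ fun i _ => ((mm i).pow_const 2).div_const _
  have iA' : ∀ i, Integrable (fun q : X × Y => m i q.2 / σ ^ 2 * φ i q.1)
      (p.compProd W.kernel) := fun i => by
    have := (integrable_fun_mul (W.memLp_posteriorMean (hφm i) (hφ i))
      (W.memLp_comp_fst (hφ i))).div_const ((σ : ℝ) ^ 2)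
    refine this.congr (Filter.Eventually.of_forall fun q => ?_)
    simp only [hm]
    ring
  have iB' : ∀ i, Integrable (fun q : X × Y => m i q.2 ^ 2 / (2 * σ ^ 2))
      (p.compProd W.kernel) := fun i =>
    (W.memLp_posteriorMean (hφm i) (hφ i)).integrable_sq.div_const _
  have iA : Integrable A (p.compProd W.kernel) := integrable_finsetSum _ fun i _ => iA' i
  have iB : Integrable (fun q : X × Y => B q.2) (p.compProd W.kernel) :=
    integrable_finsetSum _ fun i _ => iB' i
  have hexp : ∫⁻ q : X × Y, ENNReal.ofReal (Real.exp (A q - B q.2))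
      ∂(p.prod (p.bind W.kernel)) ≤ 1 := by
    rw [lintegral_prod_symm _ (by fun_prop)]
    refine (lintegral_mono fun y => ?_ : _ ≤ ∫⁻ y, 1 ∂(p.bind W.kernel)).trans_eq (by simp)
    have h1 := lintegral_exp_sum_le_of_subgaussian hsub fun i => m i y / σ ^ 2
    have e : (σ : ℝ) ^ 2 * (∑ i, (m i y / σ ^ 2) ^ 2) / 2 = B y := by
      rw [hB, Finset.mul_sum, Finset.sum_div]
      refine Finset.sum_congr rfl fun i _ => ?_
      field_simp
    rw [e] at h1
    simp_rw [sub_eq_add_neg, Real.exp_add, ENNReal.ofReal_mul (Real.exp_nonneg _)]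
    rw [lintegral_mul_const' _ _ ENNReal.ofReal_ne_top]
    refine (mul_le_mul_left h1 _).trans_eq ?_
    rw [← ENNReal.ofReal_mul (Real.exp_nonneg _), ← Real.exp_add]
    simp
  have hdv := integral_le_toReal_klDiv hkl (mA.sub (mB.comp measurable_snd)) (iA.sub iB) hexp
  have e1 : ∫ q, A q ∂(p.compProd W.kernel) =
      (∑ i, ∫ q : X × Y, m i q.2 ^ 2 ∂(p.compProd W.kernel)) / σ ^ 2 := by
    rw [hA, integral_finsetSum _ fun i _ => iA' i, Finset.sum_div]
    refine Finset.sum_congr rfl fun i _ => ?_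
    rw [← W.integral_posteriorMean_mul (hφm i) (hφ i), ← integral_div]
    refine integral_congr_ae (Filter.Eventually.of_forall fun q => ?_)
    simp only [hm]
    ring
  have e2 : ∫ q : X × Y, B q.2 ∂(p.compProd W.kernel) =
      (∑ i, ∫ q : X × Y, m i q.2 ^ 2 ∂(p.compProd W.kernel)) / (2 * σ ^ 2) := by
    rw [hB, integral_finsetSum _ fun i _ => iB' i, Finset.sum_div]
    exact Finset.sum_congr rfl fun i _ => integral_div _ _
  simp only [Pi.sub_apply, Function.comp_apply] at hdv
  rw [integral_sub iA iB, e1, e2] at hdv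
  set S := ∑ i, ∫ q : X × Y, m i q.2 ^ 2 ∂(p.compProd W.kernel)
  have e3 : S / (σ : ℝ) ^ 2 - S / (2 * σ ^ 2) = S / (2 * σ ^ 2) := by
    field_simp
    ring
  rw [e3, div_le_iff₀ (by positivity)] at hdv
  linarith

/-- The `i`-th divergence is `a_i²` times the second moment of the posterior mean of `φ i`, to which
the mutual-information bound applies. -/
lemma sum_outChiSq_le_klDiv {ι : Type*} [Fintype ι] [DecidableEq ι]
    (W : Channel X μ) {p : Measure X} [IsProbabilityMeasure p] {q : ι → Measure X}
    [∀ i, IsProbabilityMeasure (q i)] (hqp : ∀ i, q i ≪ p) {a : ι → ℝ} {φ : ι → X → ℝ} {α : ℝ}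
    (hψ : ∀ i, ∀ᵐ x ∂p, ((q i).rnDeriv p x).toReal = 1 + a i * φ i x)
    (ha : ∀ i, |a i| ≤ α) (hφm : ∀ i, Measurable (φ i)) (hφ : ∀ i, MemLp (φ i) 2 p)
    (horth : ∀ i j, ∫ x, φ i x * φ j x ∂p = if i = j then 1 else 0) {σ : ℝ≥0}
    (hsub : ∀ v : EuclideanSpace ℝ ι, ‖v‖ = 1 →
      HasSubgaussianMGF (fun x => ∑ i, v i * φ i x) (σ ^ 2) p) :
    ∑ i, W.outChiSq p (q i) ≤ ENNReal.ofReal (α ^ 2) * (ENNReal.ofReal (2 * σ ^ 2) *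
      InformationTheory.klDiv (p.compProd W.kernel) (p.prod (p.bind W.kernel))) := by
  rcases isEmpty_or_nonempty ι with hι | ⟨⟨i₀⟩⟩
  · simp
  -- With `σ = 0` the variable `φ i₀` would vanish almost surely, against `E[φ²] = 1`. Nonvanishing
  -- permits division by `σ²` and makes the bound infinite when the divergence is.
  have hσ : σ ≠ 0 := by
    rintro rfl
    have h0 := hsub (EuclideanSpace.single i₀ 1) (by simp)
    have e : (fun x => ∑ i, (EuclideanSpace.single i₀ (1 : ℝ)) i * φ i x) = φ i₀ := by
      funext x
      simp
    rw [e] at h0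
    have h1 : φ i₀ =ᵐ[p] 0 := HasSubgaussianMGF.ae_eq_zero_of_hasSubgaussianMGF_zero
      (by simpa using h0)
    have h2 : ∫ x, φ i₀ x * φ i₀ x ∂p = ∫ _, (0 : ℝ) ∂p := integral_congr_ae (by
      filter_upwards [h1] with x hx
      simp [hx])
    rw [horth] at h2
    simp at h2
  have hs : (0 : ℝ) < 2 * σ ^ 2 := by positivity
  by_cases hα : α = 0
  · have ha0 : ∀ i, a i = 0 := fun i => abs_nonpos_iff.1 (hα ▸ ha i)
    refine (Finset.sum_nonpos fun i _ => ?_).trans zero_le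
    refine (lintegral_eq_zero_of_ae_eq_zero ?_).le
    filter_upwards [W.outDensity_mul_sq_outRatio_sub_one_ae (hqp i) (hψ i)] with y hy
    simp [hy.2.2.2, ha0]
  by_cases hkl : InformationTheory.klDiv (p.compProd W.kernel) (p.prod (p.bind W.kernel)) = ∞
  · rw [hkl, ENNReal.mul_top (by simpa using hσ), ENNReal.mul_top (by simpa using hα)]
    exact le_top
  have hS := W.sum_integral_sq_posteriorMean_le hφm hφ hσ hsub hkl
  have hm : ∀ i, Measurable fun s : X × Y => W.posteriorMean p (φ i) s.2 :=
    fun i => (W.measurable_posteriorMean p (hφm i)).comp measurable_snd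
  have hchi : ∀ i, W.outChiSq p (q i) ≤ ENNReal.ofReal (α ^ 2) *
      ENNReal.ofReal (∫ s : X × Y, W.posteriorMean p (φ i) s.2 ^ 2 ∂(p.compProd W.kernel)) := by
    intro i
    have := hm i
    rw [ofReal_integral_eq_lintegral_ofReal (W.memLp_posteriorMean (hφm i) (hφ i)).integrable_sq
      (Filter.Eventually.of_forall fun s => sq_nonneg _),
      W.lintegral_compProd_kernel p (by fun_prop), ← lintegral_const_mul' _ _ ENNReal.ofReal_ne_top]
    refine lintegral_mono_ae ?_
    filter_upwards [W.outDensity_ae_lt_top p, W.posteriorMean_ae (hφm i) (hφ i),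
      W.outDensity_mul_sq_outRatio_sub_one_ae (hqp i) (hψ i)] with y hy hpm hc
    rw [lintegral_mul_const _ (W.measurable_density_left y).coe_nnreal_ennreal, hc.2.2.2]
    change _ ≤ _ * (W.outDensity p y * _)
    by_cases h0 : W.outDensity p y = 0
    · simp [h0]
    have h0' : (W.outDensity p y).toReal ≠ 0 := ENNReal.toReal_ne_zero.2 ⟨h0, hy.ne⟩
    have h0'' : 0 ≤ (W.outDensity p y).toReal := ENNReal.toReal_nonneg
    simp_rw [mul_assoc, integral_const_mul]
    rw [← hpm.1, ← ENNReal.ofReal_coe_nnreal]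
    have e : W.outDensity p y * ENNReal.ofReal (W.posteriorMean p (φ i) y ^ 2) =
        ENNReal.ofReal ((W.outDensity p y).toReal * W.posteriorMean p (φ i) y ^ 2) := by
      rw [ENNReal.ofReal_mul h0'', ENNReal.ofReal_toReal hy.ne]
    rw [e, ← ENNReal.ofReal_mul (sq_nonneg _)]
    refine ENNReal.ofReal_le_ofReal ?_
    push_cast
    rw [Real.coe_toNNReal _ (sq_nonneg _)]
    have ha2 : a i ^ 2 ≤ α ^ 2 := sq_le_sq' (by linarith [abs_le.1 (ha i)]) (abs_le.1 (ha i)).2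
    calc _ = a i ^ 2 * ((W.outDensity p y).toReal * W.posteriorMean p (φ i) y ^ 2) := by
          field_simp
      _ ≤ _ := mul_le_mul_of_nonneg_right ha2 (mul_nonneg h0'' (sq_nonneg _))
  refine (Finset.sum_le_sum fun i _ => hchi i).trans ?_
  rw [← Finset.mul_sum, ← ENNReal.ofReal_sum_of_nonneg fun i _ => integral_nonneg fun s =>
    sq_nonneg _]
  refine mul_le_mul_right ?_ _
  rw [← ENNReal.ofReal_toReal hkl, ← ENNReal.ofReal_mul hs.le]
  exact ENNReal.ofReal_le_ofReal hS

end Channel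

end InfoContraction
namespace InfoContraction

/-! ### Measures with successive conditional densities -/

lemma lintegral_pi_prod {X : Type*} [MeasurableSpace X] (p : Measure X) [SigmaFinite p] :
    ∀ (n : ℕ) (g : Fin n → X → ℝ≥0∞) (_ : ∀ t, Measurable (g t)),
      ∫⁻ x, ∏ t, g t (x t) ∂(Measure.pi fun _ : Fin n => p) = ∏ t, ∫⁻ x, g t x ∂p
  | 0, g, _ => by simp
  | n + 1, g, hg => by
    have hm : Measurable fun x : Fin (n + 1) → X => ∏ t, g t (x t) :=
      Finset.measurable_prod _ fun t _ => (hg t).comp (measurable_pi_apply t)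
    rw [lintegral_pi_fin_succ p hm, Fin.prod_univ_succ]
    simp_rw [Fin.prod_univ_succ, Fin.cons_zero, Fin.cons_succ]
    have : Measurable fun x : Fin n → X => ∏ t : Fin n, g t.succ (x t) :=
      Finset.measurable_prod _ fun t _ => (hg t.succ).comp (measurable_pi_apply t)
    simp_rw [lintegral_const_mul _ this, lintegral_pi_prod p n (fun t => g t.succ) fun t => hg _]
    rw [lintegral_mul_const _ (hg 0)]

section SeqMeasure

variable {C Y : Type*} [MeasurableSpace C] [MeasurableSpace Y] {n : ℕ}

lemma lintegral_seqProd_eq_one (μ : Measure Y) [SigmaFinite μ] :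
    ∀ (n : ℕ) (f : ∀ t : Fin n, (Fin t → Y) → Y → ℝ≥0∞)
      (_ : ∀ t : Fin n, Measurable fun q : (Fin t → Y) × Y => f t q.1 q.2)
      (_ : ∀ t h, ∫⁻ b, f t h b ∂μ = 1),
      ∫⁻ y, seqProd f y ∂(Measure.pi fun _ : Fin n => μ) = 1
  | 0, f, _, _ => by simp [seqProd]
  | n + 1, f, hf, h1 => by
    rw [lintegral_pi_fin_succ μ (measurable_seqProd' hf)]
    simp_rw [seqProd_cons]
    refine Eq.trans (lintegral_congr fun b => ?_) (h1 0 emptyHistory)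
    have mf' : ∀ t : Fin n, Measurable fun q : (Fin t → Y) × Y => seqTail f b t q.1 q.2 :=
      fun t => (measurable_seqTail hf t).comp (measurable_const.prodMk measurable_id)
    rw [lintegral_const_mul _ (measurable_seqProd' mf'),
      lintegral_seqProd_eq_one μ n _ mf' fun t h => h1 t.succ _, mul_one]

/-- The measure whose density with respect to `B ⊗ μ^n` is a product of successive conditional
densities. -/
noncomputable def seqMeasure (B : Measure C) (μ : Measure Y)
    (f : C → ∀ t : Fin n, (Fin t → Y) → Y → ℝ≥0∞) : Measure (C × (Fin n → Y)) :=
  (B.prod (Measure.pi fun _ : Fin n => μ)).withDensity fun ω => seqProd (f ω.1) ω.2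

variable {B : Measure C} {μ : Measure Y} {f g : C → ∀ t : Fin n, (Fin t → Y) → Y → ℝ≥0∞}

lemma seqMeasure_mul
    (hf : ∀ t : Fin n, Measurable fun q : C × (Fin t → Y) × Y => f q.1 t q.2.1 q.2.2)
    (hg : ∀ t : Fin n, Measurable fun q : C × (Fin t → Y) × Y => g q.1 t q.2.1 q.2.2) :
    seqMeasure B μ (fun c t h b => f c t h b * g c t h b) =
      (seqMeasure B μ f).withDensity fun ω => seqProd (g ω.1) ω.2 := by
  rw [seqMeasure, seqMeasure, ← withDensity_mul _ (measurable_seqProd hf) (measurable_seqProd hg)]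
  congr 1
  funext ω
  exact Finset.prod_mul_distrib

variable [SigmaFinite μ]

lemma lintegral_seqMeasure
    (hf : ∀ t : Fin n, Measurable fun q : C × (Fin t → Y) × Y => f q.1 t q.2.1 q.2.2)
    {H : C × (Fin n → Y) → ℝ≥0∞} (hH : Measurable H) :
    ∫⁻ ω, H ω ∂(seqMeasure B μ f) =
      ∫⁻ c, ∫⁻ y, seqProd (f c) y * H (c, y) ∂(Measure.pi fun _ : Fin n => μ) ∂B := by
  have hF := measurable_seqProd hf
  rw [seqMeasure, lintegral_withDensity_eq_lintegral_mul _ hF hH,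
    lintegral_prod _ (hF.mul hH).aemeasurable]
  rfl

lemma isProbabilityMeasure_seqMeasure [IsProbabilityMeasure B]
    (hf : ∀ t : Fin n, Measurable fun q : C × (Fin t → Y) × Y => f q.1 t q.2.1 q.2.2)
    (h1 : ∀ c t h, ∫⁻ b, f c t h b ∂μ = 1) : IsProbabilityMeasure (seqMeasure B μ f) := by
  constructor
  rw [← lintegral_one, lintegral_seqMeasure hf measurable_const]
  simp only [mul_one]
  have : ∀ c, ∫⁻ y, seqProd (f c) y ∂(Measure.pi fun _ : Fin n => μ) = 1 := fun c =>
    lintegral_seqProd_eq_one μ n _ (fun t => (hf t).comp (measurable_const.prodMk measurable_id))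
      (h1 c)
  simp [this]

/-- Factors agree only up to a null set depending on the history. This allows output densities,
possibly infinite on null sets, to be replaced by finite ones. -/
lemma seqMeasure_congr
    (hf : ∀ t : Fin n, Measurable fun q : C × (Fin t → Y) × Y => f q.1 t q.2.1 q.2.2)
    (hg : ∀ t : Fin n, Measurable fun q : C × (Fin t → Y) × Y => g q.1 t q.2.1 q.2.2)
    (hfg : ∀ c t h, f c t h =ᵐ[μ] g c t h) : seqMeasure B μ f = seqMeasure B μ g := by
  ext A hA
  have hm : Measurable (A.indicator (1 : C × (Fin n → Y) → ℝ≥0∞)) := measurable_one.indicator hA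
  rw [← lintegral_indicator_one hA, ← lintegral_indicator_one hA, lintegral_seqMeasure hf hm,
    lintegral_seqMeasure hg hm]
  refine lintegral_congr fun c => ?_
  exact lintegral_seqProd_mul_congr μ n _ _
    (fun t => (hf t).comp (measurable_const.prodMk measurable_id))
    (fun t => (hg t).comp (measurable_const.prodMk measurable_id)) (hfg c) _
    (hm.comp (measurable_const.prodMk measurable_id))

end SeqMeasure

lemma coe_seqProd {Y : Type*} {n : ℕ} (f : ∀ t : Fin n, (Fin t → Y) → Y → ℝ≥0) (y : Fin n → Y) :
    ((seqProd f y : ℝ≥0) : ℝ≥0∞) = seqProd (fun t h b => (f t h b : ℝ≥0∞)) y :=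
  map_prod ENNReal.ofNNRealHom _ _

/-! ### The law of the messages and of the randomness -/

namespace SeqProtocol

variable {X Y : Type*} [MeasurableSpace X] [MeasurableSpace Y] {μ : Measure Y}
  {n : ℕ} {𝒲 : Fin n → Set (Channel X μ)} {𝒰 : Type*} [MeasurableSpace 𝒰] {𝒱 : Fin n → Type*}
  [∀ t, MeasurableSpace (𝒱 t)] (P : SeqProtocol 𝒲 𝒰 𝒱)

/-- The channel used by player `t` given all the randomness and the earlier messages. -/
def channel (c : 𝒰 × ∀ t, 𝒱 t) (t : Fin n) (h : Fin t → Y) : Channel X μ :=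
  P.select t c.1 (c.2 t) fun s => h ⟨s.1, s.2⟩

/-- The joint law of the public and private randomness. -/
noncomputable def randomnessLaw : Measure (𝒰 × ∀ t, 𝒱 t) :=
  P.publicLaw.prod (Measure.pi P.privateLaw)

lemma isProbabilityMeasure_randomnessLaw : IsProbabilityMeasure P.randomnessLaw := by
  have := P.isProbabilityMeasure_publicLaw
  have := P.isProbabilityMeasure_privateLaw
  unfold randomnessLaw
  infer_instance

lemma measurable_channel_density (t : Fin n) :
    Measurable fun q : ((𝒰 × ∀ t, 𝒱 t) × (Fin t → Y) × Y) × X =>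
      (P.channel q.1.1 t q.1.2.1).density q.2 q.1.2.2 := by
  have hh : Measurable fun q : ((𝒰 × ∀ t, 𝒱 t) × (Fin t → Y) × Y) × X =>
      fun s : Set.Iio t => q.1.2.1 ⟨s.1, s.2⟩ :=
    measurable_pi_lambda _ fun s => (measurable_pi_apply _).comp
      (measurable_fst.comp (measurable_snd.comp measurable_fst))
  have hu : Measurable fun q : ((𝒰 × ∀ t, 𝒱 t) × (Fin t → Y) × Y) × X => q.1.1.1 := by fun_prop
  have hv : Measurable fun q : ((𝒰 × ∀ t, 𝒱 t) × (Fin t → Y) × Y) × X => q.1.1.2 t := by fun_prop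
  have hx : Measurable fun q : ((𝒰 × ∀ t, 𝒱 t) × (Fin t → Y) × Y) × X => q.2 := by fun_prop
  have hy : Measurable fun q : ((𝒰 × ∀ t, 𝒱 t) × (Fin t → Y) × Y) × X => q.1.2.2 := by fun_prop
  exact (P.measurable_select t).comp (hu.prodMk (hv.prodMk (hh.prodMk (hx.prodMk hy))))

lemma measurable_channel_outDensity (p : Measure X) [SFinite p] (t : Fin n) :
    Measurable fun q : (𝒰 × ∀ t, 𝒱 t) × (Fin t → Y) × Y =>
      (P.channel q.1 t q.2.1).outDensity p q.2.2 :=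
  Measurable.lintegral_prod_right' (P.measurable_channel_density t).coe_nnreal_ennreal

lemma measurable_channel_outRatio (p q : Measure X) [SFinite p] [SFinite q] (t : Fin n) :
    Measurable fun s : (𝒰 × ∀ t, 𝒱 t) × (Fin t → Y) × Y =>
      (P.channel s.1 t s.2.1).outRatio p q s.2.2 :=
  (P.measurable_channel_outDensity q t).ennreal_toNNReal.div
    (P.measurable_channel_outDensity p t).ennreal_toNNReal

/-- The joint law of all the randomness and of the messages. -/
noncomputable def observedLaw (p : Measure X) : Measure ((𝒰 × ∀ t, 𝒱 t) × (Fin n → Y)) :=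
  (P.jointLaw p).map fun ω => (ω.1, ω.2.2)

lemma messageLaw_eq_map (p : Measure X) : P.messageLaw p = (P.observedLaw p).map Prod.snd := by
  rw [observedLaw, Measure.map_map measurable_snd (by fun_prop)]
  rfl

lemma transcriptLaw_eq_map (p : Measure X) :
    P.transcriptLaw p = (P.observedLaw p).map fun ω => (ω.2, ω.1.1) := by
  rw [observedLaw, Measure.map_map (by fun_prop) (by fun_prop)]
  rfl

/-- The likelihood ratio of the joint laws of the randomness and the messages. -/
noncomputable def likelihoodRatio (p q : Measure X) (ω : (𝒰 × ∀ t, 𝒱 t) × (Fin n → Y)) : ℝ≥0 :=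
  seqProd (fun t h => (P.channel ω.1 t h).outRatio p q) ω.2

lemma measurable_likelihoodRatio (p q : Measure X) [IsProbabilityMeasure p]
    [IsProbabilityMeasure q] : Measurable (P.likelihoodRatio p q) :=
  measurable_seqProd (f := fun c t h => (P.channel c t h).outRatio p q)
    (P.measurable_channel_outRatio p q)

variable [SigmaFinite μ]

/-- For fixed randomness and messages the joint density is a product of functions of separate inputs
`x_t`, so the i.i.d. inputs integrate out factor by factor. -/
lemma map_jointLaw (p : Measure X) [IsProbabilityMeasure p] :
    (P.jointLaw p).map (fun ω => (ω.1, ω.2.2)) =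
      seqMeasure P.randomnessLaw μ fun c t h => (P.channel c t h).outDensity p := by
  have := P.isProbabilityMeasure_randomnessLaw
  have hg : Measurable fun ω : (𝒰 × ∀ t, 𝒱 t) × ((Fin n → X) × (Fin n → Y)) => (ω.1, ω.2.2) := by
    fun_prop
  have hD : Measurable fun ω : (𝒰 × ∀ t, 𝒱 t) × ((Fin n → X) × (Fin n → Y)) =>
      ∏ t : Fin n, (((P.select t ω.1.1 (ω.1.2 t) (fun s : Set.Iio t => ω.2.2 s)).density
        (ω.2.1 t) (ω.2.2 t) : ℝ≥0) : ℝ≥0∞) := by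
    refine Finset.measurable_prod _ fun t _ => Measurable.coe_nnreal_ennreal ?_
    have hh : Measurable fun ω : (𝒰 × ∀ t, 𝒱 t) × ((Fin n → X) × (Fin n → Y)) =>
        fun s : Set.Iio t => ω.2.2 s :=
      measurable_pi_lambda _ fun s => (measurable_pi_apply _).comp
        (measurable_snd.comp measurable_snd)
    have hu : Measurable fun ω : (𝒰 × ∀ t, 𝒱 t) × ((Fin n → X) × (Fin n → Y)) => ω.1.1 := by
      fun_prop
    have hv : Measurable fun ω : (𝒰 × ∀ t, 𝒱 t) × ((Fin n → X) × (Fin n → Y)) => ω.1.2 t := by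
      fun_prop
    have hx : Measurable fun ω : (𝒰 × ∀ t, 𝒱 t) × ((Fin n → X) × (Fin n → Y)) => ω.2.1 t := by
      fun_prop
    have hy : Measurable fun ω : (𝒰 × ∀ t, 𝒱 t) × ((Fin n → X) × (Fin n → Y)) => ω.2.2 t := by
      fun_prop
    exact (P.measurable_select t).comp (hu.prodMk (hv.prodMk (hh.prodMk (hx.prodMk hy))))
  ext A hA
  have hI : Measurable (A.indicator (1 : (𝒰 × ∀ t, 𝒱 t) × (Fin n → Y) → ℝ≥0∞)) :=
    measurable_one.indicator hA
  have hIg : Measurable fun ω : (𝒰 × ∀ t, 𝒱 t) × ((Fin n → X) × (Fin n → Y)) =>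
      A.indicator (1 : (𝒰 × ∀ t, 𝒱 t) × (Fin n → Y) → ℝ≥0∞) (ω.1, ω.2.2) := hI.comp hg
  rw [← lintegral_indicator_one hA, ← lintegral_indicator_one hA, lintegral_map hI hg,
    lintegral_seqMeasure (P.measurable_channel_outDensity p) hI, jointLaw,
    lintegral_withDensity_eq_lintegral_mul _ hD hIg,
    lintegral_prod _ (hD.mul hIg).aemeasurable]
  refine lintegral_congr fun c => ?_
  have hc : Measurable fun s : (Fin n → X) × (Fin n → Y) => (c, s) :=
    measurable_const.prodMk measurable_id
  refine (lintegral_prod_symm _ ((hD.mul hIg).comp hc).aemeasurable).trans ?_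
  refine lintegral_congr fun y => ?_
  have hcy : Measurable fun x : Fin n → X => (x, y) := measurable_id.prodMk measurable_const
  refine (lintegral_mul_const (A.indicator 1 (c, y)) ((hD.comp hc).comp hcy)).trans ?_
  congr 1
  exact lintegral_pi_prod p n (fun t x => ((P.select t c.1 (c.2 t) (fun s => y s)).density x (y t) :
    ℝ≥0∞)) fun t => (Channel.measurable_density_left _ _).coe_nnreal_ennreal

lemma observedLaw_eq (p : Measure X) [IsProbabilityMeasure p] :
    P.observedLaw p = seqMeasure P.randomnessLaw μ fun c t h b =>
      (((P.channel c t h).outDensity p b).toNNReal : ℝ≥0∞) := by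
  rw [observedLaw, map_jointLaw]
  refine seqMeasure_congr (P.measurable_channel_outDensity p) (fun t => ?_) fun c t h => ?_
  · exact (P.measurable_channel_outDensity p t).ennreal_toNNReal.coe_nnreal_ennreal
  · exact ((P.channel c t h).coe_toNNReal_outDensity_ae p).symm

lemma isProbabilityMeasure_observedLaw (p : Measure X) [IsProbabilityMeasure p] :
    IsProbabilityMeasure (P.observedLaw p) := by
  have := P.isProbabilityMeasure_randomnessLaw
  rw [observedLaw, map_jointLaw]
  exact isProbabilityMeasure_seqMeasure (P.measurable_channel_outDensity p)
    fun c t h => Channel.lintegral_outDensity _ p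

/-- The randomness has the same law under both inputs, so only the messages contribute to the
likelihood ratio. -/
lemma observedLaw_eq_withDensity {p q : Measure X} [IsProbabilityMeasure p]
    [IsProbabilityMeasure q] (hqp : q ≪ p) :
    P.observedLaw q =
      (P.observedLaw p).withDensity fun ω => (P.likelihoodRatio p q ω : ℝ≥0∞) := by
  have := P.isProbabilityMeasure_randomnessLaw
  have m1 := fun t => (P.measurable_channel_outDensity p t).ennreal_toNNReal.coe_nnreal_ennreal
  have m2 := fun t => (P.measurable_channel_outRatio p q t).coe_nnreal_ennreal
  rw [observedLaw_eq P p, observedLaw, map_jointLaw]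
  simp_rw [likelihoodRatio, coe_seqProd]
  have h := seqMeasure_mul (B := P.randomnessLaw) (μ := μ)
    (f := fun c t h b => ((P.channel c t h).outDensity p b).toNNReal)
    (g := fun c t h b => (P.channel c t h).outRatio p q b) m1 m2
  refine Eq.trans ?_ h
  refine seqMeasure_congr (P.measurable_channel_outDensity q) (fun t => (m1 t).mul (m2 t))
    fun c t h => ?_
  filter_upwards [(P.channel c t h).outDensity_mul_outRatio_ae hqp] with b hb
  rw [← hb, ENNReal.coe_mul]

/-- The randomness is frozen, which makes the channels deterministic functions of the history; the
resulting bound is uniform in the randomness and is then averaged. -/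
lemma sum_lintegral_inv_one_add_likelihoodRatio_le {ι : Type*} [Fintype ι] {p : Measure X}
    [IsProbabilityMeasure p] {q : ι → Measure X} [∀ i, IsProbabilityMeasure (q i)]
    (hqp : ∀ i, q i ≪ p) {C : Fin n → ℝ≥0∞}
    (hC : ∀ t, ∀ W ∈ 𝒲 t, ∑ i, W.outChiSq p (q i) ≤ C t) :
    ∑ i, ∫⁻ ω, (((1 + P.likelihoodRatio p (q i) ω)⁻¹ : ℝ≥0) : ℝ≥0∞) ∂(P.observedLaw p) ≤
      Fintype.card ι / 2 + ∑ t, C t := by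
  have := P.isProbabilityMeasure_randomnessLaw
  have mD := fun t => (P.measurable_channel_outDensity p t).ennreal_toNNReal
  have mR := fun i => P.measurable_likelihoodRatio p (q i)
  have mH : ∀ i, Measurable fun ω => (((1 + P.likelihoodRatio p (q i) ω)⁻¹ : ℝ≥0) : ℝ≥0∞) :=
    fun i => by have := mR i; fun_prop
  rw [← lintegral_finsetSum _ fun i _ => mH i, observedLaw_eq,
    lintegral_seqMeasure (fun t => (mD t).coe_nnreal_ennreal)
      (Finset.measurable_sum _ fun i _ => mH i)]
  refine (lintegral_mono fun c => ?_ : _ ≤ ∫⁻ _, Fintype.card ι / 2 + ∑ t, C t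
    ∂P.randomnessLaw).trans_eq (by simp)
  have m1 : ∀ t : Fin n, Measurable fun s : (Fin t → Y) × Y =>
      ((P.channel c t s.1).outDensity p s.2).toNNReal :=
    fun t => (mD t).comp (measurable_const.prodMk measurable_id)
  have m2 : ∀ i, ∀ t : Fin n, Measurable fun s : (Fin t → Y) × Y =>
      (P.channel c t s.1).outRatio p (q i) s.2 :=
    fun i t => (P.measurable_channel_outRatio p (q i) t).comp
      (measurable_const.prodMk measurable_id)
  -- Initial weights `1` give each coordinate the initial potential `1/2`.
  have h := sum_lintegral_potential_le μ n
    (fun t h b => ((P.channel c t h).outDensity p b).toNNReal)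
    (fun i t h => (P.channel c t h).outRatio p (q i)) C m1 m2
    (fun t h => by
      rw [lintegral_congr_ae ((P.channel c t h).coe_toNNReal_outDensity_ae p)]
      exact Channel.lintegral_outDensity _ p)
    (fun i t h => by
      rw [lintegral_congr_ae ((P.channel c t h).outDensity_mul_outRatio_ae (hqp i))]
      exact Channel.lintegral_outDensity _ (q i))
    (fun t h => hC t _ (P.select_mem t _ _ _)) (fun _ => 1)
  refine le_trans (le_of_eq ?_) (h.trans (le_of_eq ?_))
  · rw [← lintegral_finsetSum]
    · refine lintegral_congr fun y => ?_
      rw [← coe_seqProd, Finset.mul_sum]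
      refine Finset.sum_congr rfl fun i _ => ?_
      rw [← ENNReal.coe_mul, one_mul]
      rfl
    · intro i _
      have h1 := measurable_seqProd'
        (f := fun t h b => ((P.channel c t h).outDensity p b).toNNReal) m1
      have h2 := measurable_seqProd' (f := fun t h => (P.channel c t h).outRatio p (q i)) (m2 i)
      fun_prop
  · congr 1
    have h2 : (((1 + 1 : ℝ≥0)⁻¹ : ℝ≥0) : ℝ≥0∞) = 2⁻¹ := by
      rw [one_add_one_eq_two, ENNReal.coe_inv two_ne_zero]
      rfl
    simp only [h2, Finset.sum_const, Finset.card_univ, nsmul_eq_mul]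
    rfl

/-- The bound of the average discrepancy of any function of the randomness and the messages by the
sum of the maximal chi-square divergences of the outputs. -/
theorem ofReal_avgDiscrepancy_sq_le {k : ℕ} (hk : 1 ≤ k) {τ : ℝ} (h0 : 0 < τ) (h1 : τ < 1)
    {p : Cube k → Measure X} (hp : ∀ z, IsProbabilityMeasure (p z))
    (hac : ∀ z i, p (flipCoord z i) ≪ p z) {C : Fin n → ℝ≥0∞}
    (hC : ∀ z t, ∀ W ∈ 𝒲 t, ∑ i, W.outChiSq (p z) (p (flipCoord z i)) ≤ C t)
    {S : Type*} [MeasurableSpace S] {g : (𝒰 × ∀ t, 𝒱 t) × (Fin n → Y) → S} (hg : Measurable g) :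
    ENNReal.ofReal (avgDiscrepancy τ (fun z => (P.observedLaw (p z)).map g) ^ 2) ≤
      ENNReal.ofReal (2 / k) * ∑ t, C t := by
  have hkpos : (0 : ℝ) < k := by exact_mod_cast hk
  by_cases hT : ∑ t, C t = ∞
  · rw [hT, ENNReal.mul_top (by simpa using hkpos)]
    exact le_top
  have hR := fun z => P.isProbabilityMeasure_observedLaw (p z)
  have hQ : ∀ z, IsFiniteMeasure ((P.observedLaw (p z)).map g) := fun z => inferInstance
  set D := avgDiscrepancy τ (fun z => (P.observedLaw (p z)).map g) with hD
  have hDnonneg : 0 ≤ D := by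
    refine mul_nonneg (by positivity) (Finset.sum_nonneg fun i _ => ?_)
    exact Real.iSup_nonneg fun A => abs_nonneg _
  rcases hDnonneg.eq_or_lt with h | hDpos
  · simp [← h]
  set T := (∑ t, C t).toReal with hTdef
  set E : Cube k → Fin k → ℝ≥0∞ := fun z i => ∫⁻ ω,
    (((1 + P.likelihoodRatio (p z) (p (flipCoord z i)) ω)⁻¹ : ℝ≥0) : ℝ≥0∞)
      ∂(P.observedLaw (p z)) with hE
  have hEsum : ∀ z, ∑ i, (E z i).toReal ≤ k / 2 + T := by
    intro z
    have h := P.sum_lintegral_inv_one_add_likelihoodRatio_le (hac z) (hC z)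
    have hfin : (Fintype.card (Fin k) / 2 + ∑ t, C t : ℝ≥0∞) ≠ ∞ :=
      ENNReal.add_ne_top.2 ⟨ENNReal.div_ne_top (ENNReal.natCast_ne_top _) two_ne_zero, hT⟩
    have hfin' : ∀ i ∈ Finset.univ, E z i ≠ ∞ := ENNReal.sum_ne_top.1 (ne_top_of_le_ne_top hfin h)
    rw [← ENNReal.toReal_sum hfin']
    refine (ENNReal.toReal_mono hfin h).trans_eq ?_
    rw [ENNReal.toReal_add (ENNReal.div_ne_top (ENNReal.natCast_ne_top _) two_ne_zero) hT]
    simp [hTdef]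
  -- The linearisation parameter `ε` is the discrepancy `D` itself, whence `D ≤ D/2 + T/(kD)` and so
  -- `D² ≤ 2T/k`. No square root is needed, and `T` may be zero.
  have hmain := avgDiscrepancy_le h0 h1 (fun z => (P.observedLaw (p z)).map g)
    (fun z i => D / 2 + (4 * (E z i).toReal - 2) / (4 * D)) (B := k * D / 2 + T / D)
    (fun z i A hA => by
      -- Data processing: an event for the image law is pulled back to an event for the randomness
      -- and messages.
      have hpre := hg hA
      simp only [Measure.real, Measure.map_apply hg hA]
      rw [P.observedLaw_eq_withDensity (hac z i)]
      refine abs_real_sub_withDensity_real_le (P.measurable_likelihoodRatio _ _) ?_ hpre hDpos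
      have hq := hR (flipCoord z i)
      have : (P.observedLaw (p (flipCoord z i))) Set.univ = 1 := measure_univ
      rwa [P.observedLaw_eq_withDensity (hac z i), withDensity_apply _ .univ,
        Measure.restrict_univ] at this)
    (fun z => by
      rw [Finset.sum_add_distrib, ← Finset.sum_div _ _ (4 * D), Finset.sum_sub_distrib,
        ← Finset.mul_sum]
      simp only [Finset.sum_const, Finset.card_univ, Fintype.card_fin, nsmul_eq_mul]
      have h2 : (4 * ∑ i, (E z i).toReal - k * 2) / (4 * D) ≤ T / D := by
        rw [div_le_div_iff₀ (by positivity) hDpos]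
        nlinarith [hEsum z]
      have h3 : (k : ℝ) * (D / 2) = k * D / 2 := by ring
      linarith)
  rw [← hD] at hmain
  have hsq : D ^ 2 ≤ 2 / k * T := by
    have e : 1 / (k : ℝ) * (k * D / 2 + T / D) = D / 2 + T / (k * D) := by
      field_simp
    rw [e] at hmain
    have h4 : D / 2 ≤ T / (k * D) := by linarith
    rw [div_le_div_iff₀ two_pos (by positivity)] at h4
    rw [div_mul_eq_mul_div, le_div_iff₀ hkpos]
    nlinarith
  rw [← ENNReal.ofReal_toReal hT, ← ENNReal.ofReal_mul (by positivity)]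
  exact ENNReal.ofReal_le_ofReal hsq

end SeqProtocol

end InfoContraction
namespace InfoContraction

/-! ### Assembly of the two bounds -/

lemma OrthonormalPerturbations.memLp {k : ℕ} {X : Type*} [MeasurableSpace X]
    {p : Cube k → Measure X} {φ : Cube k → Fin k → X → ℝ} (h : OrthonormalPerturbations p φ)
    (hφ : ∀ z i, Measurable (φ z i)) (z : Cube k) (i : Fin k) : MemLp (φ z i) 2 (p z) := by
  refine (memLp_two_iff_integrable_sq (hφ z i).aestronglyMeasurable).2 ?_
  simpa only [sq] using (h z i i).1

lemma le_iSup_iSup_mem {X Y Z : Type*} [MeasurableSpace X] [MeasurableSpace Y] {μ : Measure Y}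
    {𝒲 : Set (Channel X μ)} (F : Z → Channel X μ → ℝ≥0∞) (z : Z) {W : Channel X μ} (hW : W ∈ 𝒲) :
    F z W ≤ ⨆ z, ⨆ W ∈ 𝒲, F z W :=
  (le_iSup₂ (f := fun W (_ : W ∈ 𝒲) => F z W) W hW).trans
    (le_iSup (fun z => ⨆ W ∈ 𝒲, F z W) z)

end InfoContraction

theorem mainTheorem2
    {X Y : Type*} [MeasurableSpace X] [MeasurableSpace Y] (μ : Measure Y) [SigmaFinite μ]
    (n k : ℕ) (hk : 1 ≤ k) (τ : ℝ) (hτ : τ ∈ Set.Ioc (0 : ℝ) (1 / 2))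
    (p : InfoContraction.Cube k → Measure X) (hp : ∀ z, IsProbabilityMeasure (p z))
    (𝒲 : Fin n → Set (InfoContraction.Channel X μ))
    {𝒰 : Type*} [MeasurableSpace 𝒰] {𝒱 : Fin n → Type*} [∀ t, MeasurableSpace (𝒱 t)]
    (P : InfoContraction.SeqProtocol 𝒲 𝒰 𝒱)
    (a : InfoContraction.Cube k → Fin k → ℝ) (φ : InfoContraction.Cube k → Fin k → X → ℝ) (α : ℝ)
    (hdens : InfoContraction.DensitiesExist p a φ α)
    (horth : InfoContraction.OrthonormalPerturbations p φ) :
    (ENNReal.ofReal (InfoContraction.avgDiscrepancy τ (fun z => P.messageLaw (p z)) ^ 2) ≤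
        ENNReal.ofReal (7 / k * α ^ 2) *
          ∑ t : Fin n, ⨆ z, ⨆ W ∈ 𝒲 t, W.normalizedVariance (p z)) ∧
    (ENNReal.ofReal (InfoContraction.avgDiscrepancy τ (fun z => P.transcriptLaw (p z)) ^ 2) ≤
        ENNReal.ofReal (7 / k * α ^ 2) *
          ∑ t : Fin n, ⨆ z, ⨆ W ∈ 𝒲 t, W.normalizedVariance (p z)) ∧
    (∀ σ : ℝ≥0, InfoContraction.SubgaussianIndep p φ σ →
      ENNReal.ofReal (InfoContraction.avgDiscrepancy τ (fun z => P.messageLaw (p z)) ^ 2) ≤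
          ENNReal.ofReal (14 * Real.log 2 / k * α ^ 2 * σ ^ 2) *
            ∑ t : Fin n, ⨆ z, ⨆ W ∈ 𝒲 t, W.mutualInfo (p z) ∧
      ENNReal.ofReal (InfoContraction.avgDiscrepancy τ (fun z => P.transcriptLaw (p z)) ^ 2) ≤
          ENNReal.ofReal (14 * Real.log 2 / k * α ^ 2 * σ ^ 2) *
            ∑ t : Fin n, ⨆ z, ⨆ W ∈ 𝒲 t, W.mutualInfo (p z)) := by
  have hφm : ∀ z i, Measurable (φ z i) := fun z i => (hdens z i).2.2.1
  have hφ := horth.memLp hφm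
  have hac : ∀ z i, p (InfoContraction.flipCoord z i) ≪ p z := fun z i => (hdens z i).1
  have hk0 : (0 : ℝ) < k := by exact_mod_cast hk
  have hτ1 : τ < 1 := by linarith [hτ.2]
  have hvar : ∀ z t, ∀ W ∈ 𝒲 t, ∑ i, W.outChiSq (p z) (p (InfoContraction.flipCoord z i)) ≤
      ENNReal.ofReal (α ^ 2) * ⨆ z, ⨆ W ∈ 𝒲 t, W.normalizedVariance (p z) := fun z t W hW =>
    (W.sum_outChiSq_le_normalizedVariance (hac z) (fun i => (hdens z i).2.2.2)
      (fun i => (hdens z i).2.1) (hφ z) fun i j => (horth z i j).2).trans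
      (mul_le_mul_right
        (InfoContraction.le_iSup_iSup_mem (fun z W => W.normalizedVariance (p z)) z hW) _)
  -- The argument gives the constant `2`, which is relaxed to `7`.
  have hvarC : ENNReal.ofReal (2 / k) * ∑ t : Fin n,
      ENNReal.ofReal (α ^ 2) * ⨆ z, ⨆ W ∈ 𝒲 t, W.normalizedVariance (p z) ≤
      ENNReal.ofReal (7 / k * α ^ 2) *
        ∑ t : Fin n, ⨆ z, ⨆ W ∈ 𝒲 t, W.normalizedVariance (p z) := by
    rw [← Finset.mul_sum, ← mul_assoc, ← ENNReal.ofReal_mul (by positivity)]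
    gcongr
    norm_num
  -- Messages and transcript are both images of the randomness and messages, so one bound serves
  -- both.
  simp_rw [P.messageLaw_eq_map, P.transcriptLaw_eq_map]
  refine ⟨?_, ?_, fun σ hsub => ?_⟩
  · exact (P.ofReal_avgDiscrepancy_sq_le hk hτ.1 hτ1 hp hac hvar measurable_snd).trans hvarC
  · exact (P.ofReal_avgDiscrepancy_sq_le hk hτ.1 hτ1 hp hac hvar (by fun_prop)).trans hvarC
  have hlog : 0 < Real.log 2 := Real.log_pos one_lt_two
  have hmi : ∀ z t, ∀ W ∈ 𝒲 t, ∑ i, W.outChiSq (p z) (p (InfoContraction.flipCoord z i)) ≤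
      ENNReal.ofReal (α ^ 2 * (2 * σ ^ 2 * Real.log 2)) *
        ⨆ z, ⨆ W ∈ 𝒲 t, W.mutualInfo (p z) := fun z t W hW => by
    refine (W.sum_outChiSq_le_klDiv (hac z) (fun i => (hdens z i).2.2.2)
      (fun i => (hdens z i).2.1) (hφm z) (hφ z) (fun i j => (horth z i j).2)
      fun v hv => ((hsub z).1 v hv).2).trans ?_
    rw [ENNReal.ofReal_mul (sq_nonneg _), ENNReal.ofReal_mul (p := 2 * (σ : ℝ) ^ 2) (by positivity),
      mul_assoc, mul_assoc]
    have hkl : InformationTheory.klDiv ((p z).compProd W.kernel)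
        ((p z).prod ((p z).bind W.kernel)) ≤
        ENNReal.ofReal (Real.log 2) * ⨆ z, ⨆ W ∈ 𝒲 t, W.mutualInfo (p z) := by
      -- Conversion from bits to nats.
      refine le_trans (le_of_eq ?_)
        (mul_le_mul_right
          (InfoContraction.le_iSup_iSup_mem (fun z W => W.mutualInfo (p z)) z hW) _)
      rw [InfoContraction.Channel.mutualInfo, ENNReal.mul_div_cancel (by simpa using hlog)
        ENNReal.ofReal_ne_top]
    exact mul_le_mul_right (mul_le_mul_right hkl _) _
  -- The argument gives `2 · 2 = 4` in place of `14`; the slack is the `10` below.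
  have hmiC : ENNReal.ofReal (2 / k) * ∑ t : Fin n,
      ENNReal.ofReal (α ^ 2 * (2 * σ ^ 2 * Real.log 2)) * ⨆ z, ⨆ W ∈ 𝒲 t, W.mutualInfo (p z) ≤
      ENNReal.ofReal (14 * Real.log 2 / k * α ^ 2 * σ ^ 2) *
        ∑ t : Fin n, ⨆ z, ⨆ W ∈ 𝒲 t, W.mutualInfo (p z) := by
    rw [← Finset.mul_sum, ← mul_assoc, ← ENNReal.ofReal_mul (by positivity)]
    refine mul_le_mul_left (ENNReal.ofReal_le_ofReal ?_) _
    have h : 14 * Real.log 2 / k * α ^ 2 * σ ^ 2 - 2 / k * (α ^ 2 * (2 * σ ^ 2 * Real.log 2)) =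
        10 * Real.log 2 / k * α ^ 2 * σ ^ 2 := by ring
    have h' : 0 ≤ 10 * Real.log 2 / k * α ^ 2 * σ ^ 2 := by positivity
    linarith
  exact ⟨(P.ofReal_avgDiscrepancy_sq_le hk hτ.1 hτ1 hp hac hmi measurable_snd).trans hmiC,
    (P.ofReal_avgDiscrepancy_sq_le hk hτ.1 hτ1 hp hac hmi (by fun_prop)).trans hmiC⟩
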